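/- Let $G$ be a compact Lie group; manifolds are smooth, finite-dimensional, Hausdorff, second countable and without boundary (not necessarily connected). A (special) $G$-$G$-bundle $M \xleftarrow{\pi} P \xrightarrow{\pi'} M'$ consists of manifolds $P, M, M'$ and a smooth action of $G\times G$ on $P$, written $(r,s)\cdot p = r\,p\,s^{-1}$, such that: (a) $\pi : P \to M$ is a smooth principal $G$-bundle for the right action $(p,s)\mapsto ps$; (b) the action $(r,p)\mapsto rp$ (the $\star$-action) is free, and $\pi' : P \to M' = P/\star$ is the quotient map, i.e. a surjective submersion whose fibres are exactly the $\star$-orbits; (c) for every $p\in P$ there is $g\in G$ such that the isotropy group of $p$ is $(G\times G)_p=\{(h,ghg^{-1}) : h\in G_{\pi(p)}\}$, where $G$ acts on $M$ by the action induced by the $\star$-action, $r\cdot\pi(p)=\pi(rp)$. The group $G$ acts on $M'$ by the action induced by the principal action, $s\cdot\pi'(p)=\pi'(ps^{-1})$. Let $M \xleftarrow{\pi} P \xrightarrow{\pi'} M'$ be such a $G$-$G$-bundle. Then for every $G$-invariant smooth Riemannian metric $g_M$ on $M$ there is a $G$-invariant smooth Riemannian metric $g_{M'}$ on $M'$ such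 that the orbit spaces $M/G$ and $M'/G$, each with its orbit distance $d(Gx,Gy)=\inf_{a,b\in G} d(ax,by)$, where $d$ is the Riemannian distance (with value $\infty$ between points in different connected components), are isometric as metric spaces: there is a bijection $M/G\to M'/G$ that preserves the orbit distances. -/

import Mathlib

open scoped Manifold ContDiff ENNReal

noncomputable section

namespace GGBundle

section Bundles

variable {EG HG EP HP EM HM EM' HM' : Type*}
  [NormedAddCommGroup EG] [NormedSpace ℝ EG] [TopologicalSpace HG]
  [NormedAddCommGroup EP] [NormedSpace ℝ EP] [TopologicalSpace HP]
  [NormedAddCommGroup EM] [NormedSpace ℝ EM] [TopologicalSpace HM]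
  [NormedAddCommGroup EM'] [NormedSpace ℝ EM'] [TopologicalSpace HM']
  (IG : ModelWithCorners ℝ EG HG) (IP : ModelWithCorners ℝ EP HP)
  (IM : ModelWithCorners ℝ EM HM) (IM' : ModelWithCorners ℝ EM' HM')
  {G P M M' : Type*}
  [Group G] [TopologicalSpace G] [ChartedSpace HG G]
  [TopologicalSpace P] [ChartedSpace HP P]
  [TopologicalSpace M] [ChartedSpace HM M]
  [TopologicalSpace M'] [ChartedSpace HM' M']

/-- The `⋆`-action of `G` on a `G × G`-space: `(r, p) ↦ r p`, the action of `G × {1}`. -/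
def starAct [MulAction (G × G) P] (r : G) (p : P) : P := (r, (1 : G)) • p

/-- The principal (right) action of `G` on a `G × G`-space: `(p, s) ↦ p s`. An element `(r, s)` of
`G × G` acts by `p ↦ r p s⁻¹`, so that `p s` is the action of `(1, s⁻¹)` on `p`. -/
def principalAct [MulAction (G × G) P] (p : P) (s : G) : P := ((1 : G), s⁻¹) • p

/-- `π : P → M` is a smooth principal `G`-bundle for the right action `act` of `G` on `P`:
`π` is smooth, the action preserves the fibres of `π`, and around every point of `M` there is a
smooth local trivialization `π⁻¹(U) ≃ U × G` that carries `act` to right multiplication on the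
factor `G`. -/
structure IsPrincipalBundle (π : P → M) (act : P → G → P) : Prop where
  smooth_proj : ContMDiff IP IM ∞ π
  proj_act : ∀ (p : P) (s : G), π (act p s) = π p
  locally_trivial : ∀ x : M, ∃ e : Bundle.Trivialization G π, x ∈ e.baseSet ∧
    ContMDiffOn IP (IM.prod IG) ∞ e e.source ∧
    ContMDiffOn (IM.prod IG) IP ∞ e.toOpenPartialHomeomorph.symm e.target ∧
    ∀ p ∈ e.source, ∀ s : G, e (act p s) = ((e p).1, (e p).2 * s)

/-- `M ←π- P -π'→ M'` is a (special) `G`-`G`-bundle. `P` is a `G × G`-manifold, whose principal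
action makes `π` a principal `G`-bundle and whose `⋆`-action is free. The actions of `G` on `M`
and on `M'` are the ones that the `⋆`-action, respectively the principal action, induce
(`smul_proj` and `smul_proj'` determine them, since `π` and `π'` are onto). `M'` is the
quotient manifold `P / ⋆`: `π'` is a surjective submersion whose fibres are the `⋆`-orbits.
The isotropy groups of `G × G` on `P` are conjugate to diagonal subgroups. -/
structure IsGGBundle [MulAction (G × G) P] [MulAction G M] [MulAction G M']
    (π : P → M) (π' : P → M') : Prop where
  smooth_smul : ContMDiffSMul (IG.prod IG) IP ∞ (G × G) P
  isPrincipalBundle : IsPrincipalBundle IG IP IM π (principalAct (G := G))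
  star_free : ∀ (r : G) (p : P), starAct r p = p → r = 1
  smul_proj : ∀ (r : G) (p : P), π (starAct r p) = r • π p
  submersion' : Manifold.IsSubmersion IP IM' ∞ π'
  surjective' : Function.Surjective π'
  fibre' : ∀ p q : P, π' p = π' q ↔ ∃ r : G, starAct r p = q
  smul_proj' : ∀ (s : G) (p : P), π' (principalAct p s⁻¹) = s • π' p
  isotropy : ∀ p : P, ∃ g : G,
    (MulAction.stabilizer (G × G) p : Set (G × G)) =
      {a | ∃ h ∈ MulAction.stabilizer G (π p), a = (h, g * h * g⁻¹)}

end Bundles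

section Metrics

variable {E H : Type*} [NormedAddCommGroup E] [NormedSpace ℝ E] [TopologicalSpace H]
  (I : ModelWithCorners ℝ E H)
  (G : Type*) [Group G]
  {M : Type*} [TopologicalSpace M] [ChartedSpace H M] [IsManifold I ∞ M]

variable (M) in
/-- Smooth Riemannian metrics on the manifold `M`. -/
abbrev RiemannianMetric : Type _ :=
  Bundle.ContMDiffRiemannianMetric I ∞ E (fun x : M => TangentSpace I x)

/-- The metric `g` is `G`-invariant: `G` acts on `M` by isometries of `g`. -/
def IsInvariantMetric [MulAction G M] (g : RiemannianMetric I M) : Prop :=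
  ∀ (a : G) (x : M) (v w : TangentSpace I x),
    g.inner (a • x) (mfderiv I I (fun y : M => a • y) x v) (mfderiv I I (fun y : M => a • y) x w) =
      g.inner x v w

open scoped Bundle in
/-- The Riemannian distance of `g`: the infimum of the `g`-lengths of `C¹` paths between two points
(it is `∞` for points in different components of `M`). -/
def metricEDist (g : RiemannianMetric I M) (x y : M) : ℝ≥0∞ :=
  letI : Bundle.RiemannianBundle (fun x : M => TangentSpace I x) := ⟨g.toRiemannianMetric⟩
  Manifold.riemannianEDist I x y

/-- The orbit distance on the orbit space `M / G`: the `g`-distance between two orbits. -/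
def orbitEDist [MulAction G M] (g : RiemannianMetric I M)
    (a b : MulAction.orbitRel.Quotient G M) : ℝ≥0∞ :=
  ⨅ x ∈ a.orbit, ⨅ y ∈ b.orbit, metricEDist I g x y

end Metrics

end GGBundle

end

/-!
Both orbit spaces `M / G` and `M' / G` are the orbit space of `G × G` on `P`, because the fibres of
`π` are the orbits of the principal action and those of `π'` are the orbits of the `⋆`-action
(`IsGGBundle.mem_orbit_iff`). So it is enough to find a `G × G`-invariant metric on `P` for which
`π` is a Riemannian submersion onto `M` with the given metric, and to give `M'` the metric that makes
`π'` a Riemannian submersion: then the distance of two orbits, in `M` as in `M'`, is the distance of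
the corresponding `G × G`-orbits in `P`.

* Averaging over the compact group `G × G` gives an invariant metric `g₀` on `P`
  (`exists_invariantMetric`).
* An invariant metric on the total space of a submersion, on whose fibres a group of isometries acts
  transitively, has a quotient metric on the base (`exists_quotientMetric`). It is smooth since in
  coordinates it is given by the formula `(D A⁻¹ D*)⁻¹`, where `A` is the metric and `D` the
  differential of the submersion (`quotientForm`).
* If `q₀` is the quotient of `g₀` on `M`, then `g = g₀ + π^* (gM - q₀)` is a metric on `P`, it is
  invariant, and its quotient on `M` is `gM` (`exists_metric_with_quotient`). The metric on `M'` is the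
  quotient of `g` along `π'`.
* A Riemannian submersion does not increase distances (`metricEDist_le_of_isQuotientForm`).
  Conversely, a path in the base lifts to the total space with its length multiplied by a factor as
  close to `1` as one likes (`exists_lift_metricEDist_le`). Instead of solving the differential
  equation of the horizontal lift, one lifts short pieces of the path by local sections that are
  horizontal at one point, and moves the pieces by isometries along the fibres until they fit
  together.
-/

open scoped Topology

noncomputable section

namespace GGBundle

/-! ### Quotients of positive definite forms -/

section LinearAlgebra

/-- The form `q` on `W` is the quotient of the form `A` on `V` along `D : V → W`: there is a linear
section `h` of `D` (the horizontal lift) with values in the `A`-orthogonal complement of the kernel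
of `D`, and `q` is `A` on horizontal vectors. -/
def IsQuotientForm {V W : Type*} [AddCommGroup V] [Module ℝ V] [AddCommGroup W] [Module ℝ W]
    (A : V → V → ℝ) (D : V → W) (q : W → W → ℝ) : Prop :=
  ∃ h : W →ₗ[ℝ] V, (∀ w, D (h w) = w) ∧ ∀ w v, A (h w) v = q w (D v)

namespace IsQuotientForm

variable {V W : Type*} [AddCommGroup V] [Module ℝ V] [AddCommGroup W] [Module ℝ W]
  {A : V → V → ℝ} {D : V → W} {q q' : W → W → ℝ}

lemma symm (hq : IsQuotientForm A D q) (hA : ∀ v w, A v w = A w v) (w w' : W) :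
    q w w' = q w' w := by
  obtain ⟨h, h1, h2⟩ := hq
  rw [← h1 w', ← h2, h1, hA, h2, h1]

lemma unique (hq : IsQuotientForm A D q) (hq' : IsQuotientForm A D q')
    (hA : ∀ v w, A v w = A w v) : q = q' := by
  have hs := hq'.symm hA
  obtain ⟨h, h1, h2⟩ := hq
  obtain ⟨h', h1', h2'⟩ := hq'
  ext w w'
  have e1 := h2 w (h' w')
  have e2 := h2' w' (h w)
  rw [h1'] at e1
  rw [h1] at e2
  rw [← e1, hs w w', ← e2, hA]

lemma pos (hq : IsQuotientForm A D q) (hA : ∀ v, v ≠ 0 → 0 < A v v) (hD : D 0 = 0)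
    (w : W) (hw : w ≠ 0) : 0 < q w w := by
  obtain ⟨h, h1, h2⟩ := hq
  have := h2 w (h w)
  rw [h1] at this
  rw [← this]
  refine hA _ fun h0 => hw ?_
  rw [← h1 w, h0, hD]

/-- Quotient forms are natural with respect to linear isomorphisms. -/
lemma congr {V' W' : Type*} [AddCommGroup V'] [Module ℝ V'] [AddCommGroup W'] [Module ℝ W']
    {A' : V' → V' → ℝ} {D' : V' → W'} {r : W' → W' → ℝ} (hq : IsQuotientForm A D q)
    (e : V ≃ₗ[ℝ] V') (f : W ≃ₗ[ℝ] W') (hA : ∀ v w, A' (e v) (e w) = A v w)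
    (hD : ∀ v, D' (e v) = f (D v)) (hr : ∀ v w, r (f v) (f w) = q v w) :
    IsQuotientForm A' D' r := by
  obtain ⟨h, h1, h2⟩ := hq
  refine ⟨e.toLinearMap ∘ₗ h ∘ₗ f.symm.toLinearMap, fun w => ?_, fun w v => ?_⟩
  · simp [hD, h1]
  · obtain ⟨v, rfl⟩ := e.surjective v
    obtain ⟨w, rfl⟩ := f.surjective w
    simp [hA, hD, h2, hr]

end IsQuotientForm

section Bilin

variable {V : Type*} [AddCommGroup V] [Module ℝ V] [TopologicalSpace V]
  {W : Type*} [AddCommGroup W] [Module ℝ W] [TopologicalSpace W]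
  {A : V →L[ℝ] V →L[ℝ] ℝ} {D : V →L[ℝ] W} {q q' : W →L[ℝ] W →L[ℝ] ℝ}

/-- Pythagoras for the orthogonal decomposition of `v` into horizontal and vertical parts. -/
lemma IsQuotientForm.exists_vertical (hq : IsQuotientForm (fun v w => A v w) D (fun v w => q v w))
    (hA : ∀ v w, A v w = A w v) (v : V) :
    ∃ u : V, A v v = q (D v) (D v) + A u u ∧ (u = 0 → D v = 0 → v = 0) := by
  obtain ⟨h, h1, h2⟩ := hq
  refine ⟨v - h (D v), ?_, fun hu hv => ?_⟩
  · have e1 : A (h (D v)) v = q (D v) (D v) := h2 (D v) v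
    have e2 : A (h (D v)) (h (D v)) = q (D v) (D v) := by
      have := h2 (D v) (h (D v))
      rwa [h1] at this
    simp only [map_sub, sub_apply]
    rw [hA v (h (D v)), e1, e2]
    ring
  · rw [sub_eq_zero] at hu
    rw [hu, hv, map_zero]

lemma IsQuotientForm.le (hq : IsQuotientForm (fun v w => A v w) D (fun v w => q v w))
    (hA : ∀ v w, A v w = A w v) (hA' : ∀ v, v ≠ 0 → 0 < A v v) (v : V) :
    q (D v) (D v) ≤ A v v := by
  obtain ⟨u, hu, -⟩ := hq.exists_vertical hA v
  by_cases h0 : u = 0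
  · simp [hu, h0]
  · linarith [hA' u h0]

end Bilin

section Normed

variable {V : Type*} [NormedAddCommGroup V] [NormedSpace ℝ V] [FiniteDimensional ℝ V]
  {W : Type*} [NormedAddCommGroup W] [NormedSpace ℝ W] [FiniteDimensional ℝ W]

lemma exists_coercive (B : V →L[ℝ] V →L[ℝ] ℝ) (hB : ∀ v, v ≠ 0 → 0 < B v v) :
    ∃ c > 0, ∀ v, c * ‖v‖ ^ 2 ≤ B v v := by
  have : ProperSpace V := FiniteDimensional.proper ℝ V
  rcases subsingleton_or_nontrivial V with hV | hV
  · exact ⟨1, one_pos, fun v => by simp [Subsingleton.elim v 0]⟩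
  obtain ⟨v₀, hv₀, hmin⟩ := (isCompact_sphere (0 : V) 1).exists_isMinOn
    (NormedSpace.sphere_nonempty.2 zero_le_one)
    (f := fun v => B v v) (by fun_prop)
  have hv₀' : v₀ ≠ 0 := by rintro rfl; simp at hv₀
  refine ⟨B v₀ v₀, hB _ hv₀', fun v => ?_⟩
  by_cases hv : v = 0
  · simp [hv]
  have hn : ‖v‖ ≠ 0 := norm_ne_zero_iff.2 hv
  have := hmin (show ‖v‖⁻¹ • v ∈ Metric.sphere (0 : V) 1 by simp [norm_smul, hn])
  simp only [map_smul, smul_apply, smul_eq_mul, Set.mem_ofPred_eq] at this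
  calc B v₀ v₀ * ‖v‖ ^ 2 ≤ (‖v‖⁻¹ * (‖v‖⁻¹ * B v v)) * ‖v‖ ^ 2 := by gcongr
    _ = B v v := by field_simp

/-- The quotient of a nondegenerate form `A` along `D`, by the formula `(D A⁻¹ D*)⁻¹`: the inverse
form on the dual space restricts to the dual of the quotient. -/
def quotientForm (A : V →L[ℝ] V →L[ℝ] ℝ) (D : V →L[ℝ] W) : W →L[ℝ] W →L[ℝ] ℝ :=
  (D ∘L A.inverse ∘L (ContinuousLinearMap.compL ℝ V W ℝ).flip D).inverse

lemma isInvertible_of_injective {F F' : Type*} [NormedAddCommGroup F] [NormedSpace ℝ F]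
    [FiniteDimensional ℝ F] [NormedAddCommGroup F'] [NormedSpace ℝ F'] [FiniteDimensional ℝ F']
    (f : F →L[ℝ] F') (hf : Function.Injective f)
    (hd : Module.finrank ℝ F = Module.finrank ℝ F') : f.IsInvertible :=
  ⟨(LinearEquiv.ofInjectiveOfFinrankEq (f : F →ₗ[ℝ] F') hf hd).toContinuousLinearEquiv, by
    ext; rfl⟩

lemma finrank_continuousDual : Module.finrank ℝ (V →L[ℝ] ℝ) = Module.finrank ℝ V := by
  rw [← LinearEquiv.finrank_eq (LinearMap.toContinuousLinearMap (E := V) (F' := ℝ) (𝕜 := ℝ))]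
  exact Subspace.dual_finrank_eq

lemma isInvertible_of_pos {A : V →L[ℝ] V →L[ℝ] ℝ} (hA : ∀ v, v ≠ 0 → 0 < A v v) :
    A.IsInvertible := by
  refine isInvertible_of_injective A ?_ finrank_continuousDual.symm
  rw [injective_iff_map_eq_zero]
  intro v hv
  by_contra h
  have := hA v h
  simp [hv] at this

lemma isInvertible_dual_quotient {A : V →L[ℝ] V →L[ℝ] ℝ} (hA : ∀ v, v ≠ 0 → 0 < A v v)
    {D : V →L[ℝ] W} (hD : Function.Surjective D) :
    (D ∘L A.inverse ∘L (ContinuousLinearMap.compL ℝ V W ℝ).flip D).IsInvertible := by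
  refine isInvertible_of_injective _ ?_ finrank_continuousDual
  rw [injective_iff_map_eq_zero]
  intro α hα
  have hAi := isInvertible_of_pos hA
  set z := A.inverse (α ∘L D) with hz
  have hAz : A z = α ∘L D := hAi.self_apply_inverse _
  have h0 : D z = 0 := hα
  have hz0 : z = 0 := by
    by_contra h
    have := hA z h
    simp [hAz, h0] at this
  have : α ∘L D = 0 := by rw [← hAz, hz0, map_zero]
  ext w
  obtain ⟨v, rfl⟩ := hD w
  exact congrArg (fun f => f v) this

lemma isQuotientForm_quotientForm {A : V →L[ℝ] V →L[ℝ] ℝ} (hA : ∀ v, v ≠ 0 → 0 < A v v)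
    {D : V →L[ℝ] W} (hD : Function.Surjective D) :
    IsQuotientForm (fun v w => A v w) D (fun v w => quotientForm A D v w) := by
  have hAi := isInvertible_of_pos hA
  have hC := isInvertible_dual_quotient hA hD
  refine ⟨(A.inverse ∘L (ContinuousLinearMap.compL ℝ V W ℝ).flip D ∘L
    quotientForm A D : W →L[ℝ] V), fun w => ?_, fun w v => ?_⟩
  · exact hC.self_apply_inverse w
  · change A (A.inverse (quotientForm A D w ∘L D)) v = _
    rw [hAi.self_apply_inverse]
    rfl

lemma contDiffAt_quotientForm {A : V →L[ℝ] V →L[ℝ] ℝ} (hA : ∀ v, v ≠ 0 → 0 < A v v)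
    {D : V →L[ℝ] W} (hD : Function.Surjective D) {n : WithTop ℕ∞} :
    ContDiffAt ℝ n (fun p : (V →L[ℝ] V →L[ℝ] ℝ) × (V →L[ℝ] W) => quotientForm p.1 p.2) (A, D) := by
  have := FiniteDimensional.complete ℝ V
  have := FiniteDimensional.complete ℝ W
  have h1 : ContDiffAt ℝ n (fun p : (V →L[ℝ] V →L[ℝ] ℝ) × (V →L[ℝ] W) => p.1.inverse) (A, D) :=
    ((isInvertible_of_pos hA).contDiffAt_map_inverse).comp (A, D) contDiffAt_fst
  have h3 : ContDiffAt ℝ n (fun p : (V →L[ℝ] V →L[ℝ] ℝ) × (V →L[ℝ] W) =>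
      (ContinuousLinearMap.compL ℝ V W ℝ).flip p.2) (A, D) := by fun_prop
  have h2 : ContDiffAt ℝ n (fun p : (V →L[ℝ] V →L[ℝ] ℝ) × (V →L[ℝ] W) =>
      p.2 ∘L p.1.inverse ∘L (ContinuousLinearMap.compL ℝ V W ℝ).flip p.2) (A, D) :=
    contDiffAt_snd.clm_comp (h1.clm_comp h3)
  exact ((isInvertible_dual_quotient hA hD).contDiffAt_map_inverse).comp (A, D) h2

end Normed

end LinearAlgebra

/-! ### Riemannian metrics in the frames of charts -/

section Metrics

open Bundle

variable {E H : Type*} [NormedAddCommGroup E] [NormedSpace ℝ E] [TopologicalSpace H]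
  {I : ModelWithCorners ℝ E H}
  {M : Type*} [TopologicalSpace M] [ChartedSpace H M] [IsManifold I ∞ M]

variable (I) in
/-- The local vector field around `x₀` that is constant, equal to `v`, in the chart at `x₀`. -/
def frame (x₀ : M) (v : E) (x : M) : TangentSpace I x :=
  (trivializationAt E (TangentSpace I) x₀).symmL ℝ x v

omit [IsManifold I ∞ M] in
lemma mem_baseSet_self [IsManifold I 1 M] (x : M) :
    x ∈ (trivializationAt E (TangentSpace I : M → Type _) x).baseSet :=
  FiberBundle.mem_baseSet_trivializationAt' x

omit [IsManifold I ∞ M] in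
lemma eventually_mem_baseSet [IsManifold I 1 M] (x : M) :
    ∀ᶠ y in 𝓝 x, y ∈ (trivializationAt E (TangentSpace I : M → Type _) x).baseSet :=
  (trivializationAt E (TangentSpace I : M → Type _) x).open_baseSet.mem_nhds (mem_baseSet_self x)

lemma contMDiffAt_frame (x₀ : M) (v : E) {x : M}
    (hx : x ∈ (trivializationAt E (TangentSpace I : M → Type _) x₀).baseSet) :
    ContMDiffAt I (I.prod 𝓘(ℝ, E)) ∞
      (fun y => (⟨y, frame I x₀ v y⟩ : TangentBundle I M)) x := by
  rw [(trivializationAt E (TangentSpace I : M → Type _) x₀).contMDiffAt_iff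
    ((Trivialization.mem_source _).2 hx)]
  refine ⟨contMDiffAt_id, (contMDiffAt_const (c := v)).congr_of_eventuallyEq ?_⟩
  filter_upwards [(trivializationAt E (TangentSpace I : M → Type _) x₀).open_baseSet.mem_nhds hx]
    with y hy
  simp only [frame, Trivialization.symmL_apply _ hy]
  rw [Trivialization.mk_symm _ hy, Trivialization.apply_symm_apply' _ hy]

omit [IsManifold I ∞ M] in
/-- A map into `E' →L[ℝ] F` with `E'` of finite dimension is smooth if its values on all vectors
are. -/
lemma contMDiffAt_clm_of_apply {E' F : Type*} [NormedAddCommGroup E'] [NormedSpace ℝ E']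
    [FiniteDimensional ℝ E'] [NormedAddCommGroup F] [NormedSpace ℝ F] {n : WithTop ℕ∞}
    {f : M → E' →L[ℝ] F} {x : M} (hf : ∀ v, ContMDiffAt I 𝓘(ℝ, F) n (fun y => f y v) x) :
    ContMDiffAt I 𝓘(ℝ, E' →L[ℝ] F) n f x := by
  let b := Module.finBasis ℝ E'
  have key : f = fun y => ∑ i, ContinuousLinearMap.smulRightL ℝ E' F
      (LinearMap.toContinuousLinearMap (b.coord i)) (f y (b i)) := by
    ext y v
    conv_lhs => rw [← b.sum_repr v]
    simp [-Module.Basis.sum_repr]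
  rw [key]
  refine ContMDiffAt.sum fun i _ => ?_
  exact ((ContinuousLinearMap.smulRightL ℝ E' F
    (LinearMap.toContinuousLinearMap (b.coord i))).contMDiff.contMDiffAt).comp x (hf (b i))

/-- A field of bilinear forms is smooth if it is smooth on the frames of the charts. -/
lemma contMDiffAt_of_frame [FiniteDimensional ℝ E] {n : WithTop ℕ∞}
    (b : Π x : M, TangentSpace I x →L[ℝ] TangentSpace I x →L[ℝ] ℝ) (x₀ : M)
    (hb : ∀ u v : E,
      ContMDiffAt I 𝓘(ℝ) n (fun x => b x (frame I x₀ u x) (frame I x₀ v x)) x₀) :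
    ContMDiffAt I (I.prod 𝓘(ℝ, E →L[ℝ] E →L[ℝ] ℝ)) n
      (fun x ↦ TotalSpace.mk' (E →L[ℝ] E →L[ℝ] ℝ) x (b x)) x₀ := by
  rw [contMDiffAt_hom_bundle]
  refine ⟨contMDiffAt_id, contMDiffAt_clm_of_apply fun u => contMDiffAt_clm_of_apply fun v => ?_⟩
  refine (hb u v).congr_of_eventuallyEq ?_
  filter_upwards [eventually_mem_baseSet (I := I) x₀] with x hx
  rw [inCoordinates_apply_eq₂ hx hx (Set.mem_univ _)]
  simp [frame, Trivialization.symmL_apply _ hx]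

/-- The metric `g` evaluated on two smooth vector fields along a map `f` is smooth. -/
lemma contMDiffAt_inner (g : RiemannianMetric I M) {E' H' N : Type*} [NormedAddCommGroup E']
    [NormedSpace ℝ E'] [TopologicalSpace H'] {I' : ModelWithCorners ℝ E' H'}
    [TopologicalSpace N] [ChartedSpace H' N] {f : N → M} {v w : Π y : N, TangentSpace I (f y)}
    {y : N}
    (hv : ContMDiffAt I' (I.prod 𝓘(ℝ, E)) ∞ (fun y => (⟨f y, v y⟩ : TangentBundle I M)) y)
    (hw : ContMDiffAt I' (I.prod 𝓘(ℝ, E)) ∞ (fun y => (⟨f y, w y⟩ : TangentBundle I M)) y) :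
    ContMDiffAt I' 𝓘(ℝ) ∞ (fun y => g.inner (f y) (v y) (w y)) y := by
  have hb : ContMDiffAt I' I ∞ f y := (contMDiffAt_totalSpace.1 hv).1
  have : ContMDiffAt I' (I.prod 𝓘(ℝ)) ∞
      (fun m ↦ TotalSpace.mk' ℝ (E := Bundle.Trivial M ℝ) (f m) (g.inner (f m) (v m) (w m))) y := by
    apply ContMDiffAt.clm_bundle_apply₂ (F₁ := E) (F₂ := E)
    · exact (g.contMDiff.contMDiffAt).comp y hb
    · exact hv
    · exact hw
  exact (contMDiffAt_totalSpace.1 this).2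

/-- In finite dimension, the boundedness condition on the unit balls of a Riemannian metric is
automatic. -/
def mkMetric [FiniteDimensional ℝ E]
    (b : Π x : M, TangentSpace I x →L[ℝ] TangentSpace I x →L[ℝ] ℝ)
    (hsymm : ∀ x v w, b x v w = b x w v) (hpos : ∀ x v, v ≠ 0 → 0 < b x v v)
    (hb : ContMDiff I (I.prod 𝓘(ℝ, E →L[ℝ] E →L[ℝ] ℝ)) ∞
      (fun x ↦ TotalSpace.mk' (E →L[ℝ] E →L[ℝ] ℝ) x (b x))) : RiemannianMetric I M where
  inner := b
  symm := hsymm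
  pos := hpos
  isVonNBounded x := by
    obtain ⟨c, hc, h⟩ := exists_coercive (V := E) (b x) (hpos x)
    have : Bornology.IsVonNBounded ℝ {v : E | (show E →L[ℝ] E →L[ℝ] ℝ from b x) v v < 1} := by
      rw [NormedSpace.isVonNBounded_iff, isBounded_iff_forall_norm_le]
      refine ⟨c⁻¹ + 1, fun v hv => ?_⟩
      have h1 := (h v).trans_lt hv
      have h2 : ‖v‖ ^ 2 ≤ c⁻¹ := by
        rw [← one_div, le_div_iff₀ hc]
        linarith
      have h3 : 0 < c⁻¹ := inv_pos.2 hc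
      nlinarith [norm_nonneg v]
    exact this
  contMDiff := hb

variable (I M) in
set_option synthInstance.maxHeartbeats 400000 in
set_option maxHeartbeats 1000000 in
/-- Scalar products form a convex set of bilinear forms, so that a partition of unity glues the
scalar products given by the charts. -/
theorem exists_riemannianMetric [FiniteDimensional ℝ E] [SigmaCompactSpace M] [T2Space M] :
    Nonempty (RiemannianMetric I M) := by
  let t : Π x : M, Set (TangentSpace I x →L[ℝ] TangentSpace I x →L[ℝ] ℝ) := fun x =>
    {b | (∀ v w, b v w = b w v) ∧ ∀ v, v ≠ 0 → 0 < b v v}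
  have ht : ∀ x, Convex ℝ (t x) := by
    rintro x b ⟨hb, hb'⟩ c ⟨hc, hc'⟩ r s hr hs hrs
    refine ⟨fun v w => ?_, fun v hv => ?_⟩
    · change r * b v w + s * c v w = r * b w v + s * c w v
      rw [hb v w, hc v w]
    · change 0 < r * b v v + s * c v v
      have h1 := hb' v hv
      have h2 := hc' v hv
      rcases hr.eq_or_lt with rfl | hr
      · have : s = 1 := by linarith
        subst this
        linarith
      · nlinarith [mul_pos hr h1, mul_nonneg hs h2.le]
  obtain ⟨s, hs⟩ := exists_contMDiffSection_forall_mem_convex_of_local (n := ⊤) I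
    (F_fiber := E →L[ℝ] E →L[ℝ] ℝ)
    (fun x : M => TangentSpace I x →L[ℝ] TangentSpace I x →L[ℝ] ℝ) t ht (fun x₀ => by
      let e := trivializationAt E (TangentSpace I : M → Type _) x₀
      have : e.IsLinear ℝ := inferInstanceAs
        (Trivialization.IsLinear ℝ (trivializationAt E (TangentSpace I : M → Type _) x₀))
      let L := toEuclidean (E := E)
      let ex : M → (E →L[ℝ] E) := fun x => e.continuousLinearMapAt ℝ x
      refine ⟨e.baseSet, e.open_baseSet.mem_nhds (mem_baseSet_self x₀), fun x =>
        (show E →L[ℝ] E →L[ℝ] ℝ from (innerSL ℝ).bilinearComp (L.toContinuousLinearMap ∘L ex x)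
          (L.toContinuousLinearMap ∘L ex x)),
        fun x hx => ContMDiffAt.contMDiffWithinAt ?_, fun x hx => ⟨fun v w => ?_, fun v hv => ?_⟩⟩
      · refine contMDiffAt_of_frame _ x fun u v => ?_
        have h : ∀ u : E, ContMDiffAt I 𝓘(ℝ, E) ∞
            (fun y => e.continuousLinearMapAt ℝ y (frame I x u y)) x := by
          intro u
          refine (((e.contMDiffAt_iff ((Trivialization.mem_source _).2 hx)).1
            (contMDiffAt_frame (I := I) x u (mem_baseSet_self x))).2).congr_of_eventuallyEq ?_
          filter_upwards [e.open_baseSet.mem_nhds hx] with y hy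
          rw [Trivialization.continuousLinearMapAt_apply, Trivialization.coe_linearMapAt_of_mem _ hy]
        have h' : ∀ u : E, ContMDiffAt I 𝓘(ℝ, EuclideanSpace ℝ (Fin (Module.finrank ℝ E))) ∞
            (fun y => L (e.continuousLinearMapAt ℝ y (frame I x u y))) x := fun u =>
          (L.contDiff.contMDiff.contMDiffAt).comp x (h u)
        exact ((innerSL ℝ).contDiff.contMDiff.contMDiffAt.comp x (h' u)).clm_apply (h' v)
      · exact real_inner_comm (F := EuclideanSpace ℝ (Fin (Module.finrank ℝ E))) (L (ex x w)) (L (ex x v))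
      · have : L (e.continuousLinearMapAt ℝ x v) ≠ 0 := by
          rw [Ne, map_eq_zero_iff _ L.injective]
          intro h0
          apply hv
          have h1 := e.symmL_continuousLinearMapAt (R := ℝ) hx v
          rw [h0, map_zero] at h1
          exact h1.symm
        exact real_inner_self_pos.2 this)
  exact ⟨mkMetric s (fun x => (hs x).1) (fun x => (hs x).2) s.contMDiff⟩

end Metrics

/-! ### Smooth dependence of integrals on parameters -/

section Integral

open MeasureTheory Set

variable {EK HK K : Type*} [NormedAddCommGroup EK] [NormedSpace ℝ EK] [TopologicalSpace HK]
  {IK : ModelWithCorners ℝ EK HK} [TopologicalSpace K] [ChartedSpace HK K]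
  {E : Type*} [NormedAddCommGroup E] [NormedSpace ℝ E]

lemma contMDiffOn_partial_fderiv [IsManifold IK ∞ K] {f : K → E → ℝ} {V : Set E} (hV : IsOpen V)
    (hf : ContMDiffOn (IK.prod 𝓘(ℝ, E)) 𝓘(ℝ) ∞ (Function.uncurry f) (univ ×ˢ V)) :
    ContMDiffOn (IK.prod 𝓘(ℝ, E)) 𝓘(ℝ, E →L[ℝ] ℝ) ∞ (fun p : K × E => fderiv ℝ (f p.1) p.2)
      (univ ×ˢ V) := by
  rintro ⟨k, y⟩ hy
  refine ContMDiffAt.contMDiffWithinAt ?_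
  have hfa : ContMDiffAt (IK.prod 𝓘(ℝ, E)) 𝓘(ℝ) ∞ (Function.uncurry f) (k, y) :=
    hf.contMDiffAt ((isOpen_univ.prod hV).mem_nhds hy)
  have h1 : ContMDiffAt ((IK.prod 𝓘(ℝ, E)).prod 𝓘(ℝ, E)) 𝓘(ℝ) ∞
      (Function.uncurry (fun (p : K × E) (y : E) => f p.1 y)) ((k, y), y) :=
    hfa.comp (f := fun q : (K × E) × E => (q.1.1, q.2)) ((k, y), y)
      ((contMDiffAt_fst.comp _ contMDiffAt_fst).prodMk contMDiffAt_snd)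
  have h2 := ContMDiffAt.mfderiv (m := ∞) (fun (p : K × E) (y : E) => f p.1 y) Prod.snd h1
    (contMDiffAt_snd (I := IK) (J := 𝓘(ℝ, E))) le_rfl
  simpa only [inTangentCoordinates_model_space, mfderiv_eq_fderiv] using h2

lemma continuousOn_of_contMDiffOn_prod {F : Type*} [NormedAddCommGroup F] [NormedSpace ℝ F]
    {f : K × E → F} {V : Set E}
    (hf : ContMDiffOn (IK.prod 𝓘(ℝ, E)) 𝓘(ℝ, F) ∞ f (univ ×ˢ V)) {y : E} (hy : y ∈ V) :
    Continuous (fun k => f (k, y)) := by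
  rw [← continuousOn_univ]
  exact hf.continuousOn.comp (by fun_prop) (fun k _ => ⟨mem_univ _, hy⟩)

variable [CompactSpace K] [MeasurableSpace K] [BorelSpace K] [FiniteDimensional ℝ E]

lemma hasFDerivAt_integral_param [IsManifold IK ∞ K] (μ : Measure K) [IsFiniteMeasure μ]
    {f : K → E → ℝ} {V : Set E} (hV : IsOpen V)
    (hf : ContMDiffOn (IK.prod 𝓘(ℝ, E)) 𝓘(ℝ) ∞ (Function.uncurry f) (univ ×ˢ V))
    {y : E} (hy : y ∈ V) :
    HasFDerivAt (fun y => ∫ k, f k y ∂μ) (∫ k, fderiv ℝ (f k) y ∂μ) y ∧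
      Integrable (fun k => fderiv ℝ (f k) y) μ := by
  have : ProperSpace E := FiniteDimensional.proper ℝ E
  have hd := contMDiffOn_partial_fderiv hV hf
  obtain ⟨r, hr, hrV⟩ := Metric.nhds_basis_closedBall.mem_iff.1 (hV.mem_nhds hy)
  obtain ⟨C, hC⟩ := ((isCompact_univ (X := K)).prod (isCompact_closedBall y r)).exists_bound_of_continuousOn
    (hd.continuousOn.mono (prod_mono subset_rfl hrV))
  have hint : ∀ {F : Type _} [NormedAddCommGroup F] [NormedSpace ℝ F] [FiniteDimensional ℝ F]
      {g : K → F}, Continuous g → Integrable g μ := by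
    intro F _ _ _ g hg
    have : ProperSpace F := FiniteDimensional.proper ℝ F
    exact hg.integrable_of_hasCompactSupport (HasCompactSupport.of_compactSpace g)
  have hdi := hint (continuousOn_of_contMDiffOn_prod hd hy)
  refine ⟨?_, hdi⟩
  refine hasFDerivAt_integral_of_dominated_of_fderiv_le (bound := fun _ => C)
    (F' := fun y k => fderiv ℝ (f k) y)
    (Metric.closedBall_mem_nhds y hr) ?_ ?_ hdi.aestronglyMeasurable ?_ (integrable_const _) ?_
  · filter_upwards [hV.mem_nhds hy] with z hz
    exact (continuousOn_of_contMDiffOn_prod hf hz).aestronglyMeasurable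
  · exact (continuousOn_of_contMDiffOn_prod hf hy).integrable_of_hasCompactSupport
      (HasCompactSupport.of_compactSpace _)
  · exact Filter.Eventually.of_forall fun k z hz => hC (k, z) ⟨mem_univ _, hz⟩
  · refine Filter.Eventually.of_forall fun k z hz => ?_
    have h1 : ContMDiffAt (IK.prod 𝓘(ℝ, E)) 𝓘(ℝ) ∞ (Function.uncurry f) (k, z) :=
      hf.contMDiffAt ((isOpen_univ.prod hV).mem_nhds ⟨mem_univ _, hrV hz⟩)
    have h2 : ContMDiffAt 𝓘(ℝ, E) 𝓘(ℝ) ∞ (f k) z :=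
      h1.comp (f := fun z : E => (k, z)) z (contMDiffAt_const.prodMk contMDiffAt_id)
    exact (h2.contDiffAt.differentiableAt (by simp)).hasFDerivAt

/-- Differentiation under the integral sign: the integral over a compact manifold of a smooth
function of the variable and of a parameter is smooth in the parameter. -/
lemma contDiffOn_integral_param [IsManifold IK ∞ K] (μ : Measure K) [IsFiniteMeasure μ]
    {f : K → E → ℝ} {V : Set E} (hV : IsOpen V)
    (hf : ContMDiffOn (IK.prod 𝓘(ℝ, E)) 𝓘(ℝ) ∞ (Function.uncurry f) (univ ×ˢ V)) :
    ContDiffOn ℝ ∞ (fun y => ∫ k, f k y ∂μ) V := by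
  -- the directional derivatives are again integrals of smooth families
  rw [contDiffOn_infty]
  intro n
  induction n generalizing f with
  | zero =>
    exact contDiffOn_zero.2 fun y hy =>
      (hasFDerivAt_integral_param μ hV hf hy).1.continuousAt.continuousWithinAt
  | succ n ih =>
    push_cast
    rw [contDiffOn_succ_iff_fderiv_apply hV.uniqueDiffOn]
    refine ⟨fun y hy =>
      (hasFDerivAt_integral_param μ hV hf hy).1.differentiableAt.differentiableWithinAt,
      by simp, fun v => ?_⟩
    have hd := contMDiffOn_partial_fderiv hV hf
    refine (ih (f := fun k y => fderiv ℝ (f k) y v) (hd.clm_apply contMDiffOn_const)).congr ?_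
    intro y hy
    obtain ⟨h1, h2⟩ := hasFDerivAt_integral_param μ hV hf hy
    rw [fderivWithin_of_isOpen hV hy, h1.fderiv, ContinuousLinearMap.integral_apply h2]

end Integral

/-! ### Invariant metrics of compact groups -/

section Pullback

variable {E H : Type*} [NormedAddCommGroup E] [NormedSpace ℝ E] [TopologicalSpace H]
  {I : ModelWithCorners ℝ E H}
  {M : Type*} [TopologicalSpace M] [ChartedSpace H M] [IsManifold I ∞ M]
  {E' H' : Type*} [NormedAddCommGroup E'] [NormedSpace ℝ E'] [TopologicalSpace H']
  {I' : ModelWithCorners ℝ E' H'}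
  {M' : Type*} [TopologicalSpace M'] [ChartedSpace H' M'] [IsManifold I' ∞ M']

/-- The pullback at `x` of the metric `g` along `f`. -/
def pullbackForm (g : RiemannianMetric I' M') (f : M → M') (x : M) :
    TangentSpace I x →L[ℝ] TangentSpace I x →L[ℝ] ℝ :=
  ContinuousLinearMap.precomp ℝ (mfderiv I I' f x) ∘L g.inner (f x) ∘L mfderiv I I' f x

omit [IsManifold I ∞ M] in
lemma pullbackForm_apply (g : RiemannianMetric I' M') (f : M → M') (x : M)
    (u v : TangentSpace I x) :
    pullbackForm (I := I) g f x u v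
      = g.inner (f x) (mfderiv I I' f x u) (mfderiv I I' f x v) := rfl

/-- The derivatives of the maps of a smooth family send smooth vector fields to smooth vector
fields along the maps, smoothly in the parameter. -/
lemma contMDiffAt_mfderiv_family {EN HN N : Type*} [NormedAddCommGroup EN] [NormedSpace ℝ EN]
    [TopologicalSpace HN] {IN : ModelWithCorners ℝ EN HN} [TopologicalSpace N] [ChartedSpace HN N]
    [IsManifold IN ∞ N]
    {f : N → M → M'} {b : N → M} {n₀ : N}
    (hf : ContMDiffAt (IN.prod I) I' ∞ (Function.uncurry f) (n₀, b n₀))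
    {v : Π n : N, TangentSpace I (b n)}
    (hv : ContMDiffAt IN (I.prod 𝓘(ℝ, E)) ∞ (fun n => (⟨b n, v n⟩ : TangentBundle I M)) n₀) :
    ContMDiffAt IN (I'.prod 𝓘(ℝ, E')) ∞
      (fun n => (⟨f n (b n), mfderiv I I' (f n) (b n) (v n)⟩ : TangentBundle I' M')) n₀ := by
  have hb : ContMDiffAt IN I ∞ b n₀ := (Bundle.contMDiffAt_totalSpace.1 hv).1
  have h1 := ContMDiffAt.mfderiv (m := ∞) f b hf hb le_rfl
  exact ContMDiffAt.clm_apply_of_inCoordinates h1 hv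
    (hf.comp (f := fun n => (n, b n)) n₀ (contMDiffAt_id.prodMk hb))

lemma contMDiffAt_mfderiv_frame {f : M → M'} {x : M} (hf : ContMDiffAt I I' ∞ f x)
    {v : Π y : M, TangentSpace I y}
    (hv : ContMDiffAt I (I.prod 𝓘(ℝ, E)) ∞ (fun n => (⟨n, v n⟩ : TangentBundle I M)) x) :
    ContMDiffAt I (I'.prod 𝓘(ℝ, E')) ∞
      (fun y => (⟨f y, mfderiv I I' f y (v y)⟩ : TangentBundle I' M')) x :=
  contMDiffAt_mfderiv_family (f := fun _ : M => f)
    (hf.comp (f := Prod.snd) (x, x) contMDiffAt_snd) hv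

lemma exists_frame_eq (x₀ : M) {x : M}
    (hx : x ∈ (trivializationAt E (TangentSpace I : M → Type _) x₀).baseSet)
    (u : TangentSpace I x) : ∃ u' : E, frame I x₀ u' x = u :=
  ⟨(trivializationAt E (TangentSpace I : M → Type _) x₀).continuousLinearMapAt ℝ x u,
    Bundle.Trivialization.symmL_continuousLinearMapAt _ hx u⟩

end Pullback

section Average

open MeasureTheory Set

variable {EK HK K : Type*} [NormedAddCommGroup EK] [NormedSpace ℝ EK] [TopologicalSpace HK]
  {IK : ModelWithCorners ℝ EK HK} [TopologicalSpace K] [ChartedSpace HK K]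
  [IsManifold IK ∞ K] [Group K]
  {E H : Type*} [NormedAddCommGroup E] [NormedSpace ℝ E] [TopologicalSpace H]
  {I : ModelWithCorners ℝ E H} [FiniteDimensional ℝ E]
  {M : Type*} [TopologicalSpace M] [ChartedSpace H M] [IsManifold I ∞ M]
  [MulAction K M]

omit [FiniteDimensional ℝ E] in
lemma contMDiffAt_pullback_smul
    (hs : ContMDiff (IK.prod I) I ∞ (fun p : K × M => p.1 • p.2))
    (g : RiemannianMetric I M) (x₀ : M) (u v : E) (k : K) {x : M}
    (hx : x ∈ (trivializationAt E (TangentSpace I : M → Type _) x₀).baseSet) :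
    ContMDiffAt (IK.prod I) 𝓘(ℝ) ∞ (fun p : K × M =>
      pullbackForm (I := I) g (fun y : M => p.1 • y) p.2 (frame I x₀ u p.2) (frame I x₀ v p.2))
      (k, x) := by
  have h1 : ContMDiffAt ((IK.prod I).prod I) I ∞
      (Function.uncurry (fun (p : K × M) (y : M) => p.1 • y)) ((k, x), x) :=
    hs.contMDiffAt.comp (f := fun q : (K × M) × M => (q.1.1, q.2)) ((k, x), x)
      ((contMDiffAt_fst.comp _ contMDiffAt_fst).prodMk contMDiffAt_snd)
  have h2 : ∀ u : E, ContMDiffAt (IK.prod I) (I.prod 𝓘(ℝ, E)) ∞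
      (fun p : K × M => (⟨p.2, frame I x₀ u p.2⟩ : TangentBundle I M)) (k, x) := fun u =>
    (contMDiffAt_frame x₀ u hx).comp (f := Prod.snd) (k, x) contMDiffAt_snd
  exact contMDiffAt_inner g (contMDiffAt_mfderiv_family h1 (h2 u))
    (contMDiffAt_mfderiv_family h1 (h2 v))

omit [FiniteDimensional ℝ E] in
lemma continuous_pullback_smul
    (hs : ContMDiff (IK.prod I) I ∞ (fun p : K × M => p.1 • p.2))
    (g : RiemannianMetric I M) (x : M) (u v : TangentSpace I x) :
    Continuous (fun k : K => pullbackForm (I := I) g (fun y : M => k • y) x u v) := by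
  have h : ContMDiff IK 𝓘(ℝ) ∞ (fun k : K =>
      pullbackForm (I := I) g (fun y : M => k • y) x u v) := by
    intro k
    obtain ⟨u', rfl⟩ := exists_frame_eq (I := I) x (mem_baseSet_self x) u
    obtain ⟨v', rfl⟩ := exists_frame_eq (I := I) x (mem_baseSet_self x) v
    exact (contMDiffAt_pullback_smul (IK := IK) hs g x u' v' k (mem_baseSet_self x)).comp
      (f := fun k : K => (k, x)) k (contMDiffAt_id.prodMk contMDiffAt_const)
  exact h.continuous

omit [TopologicalSpace K] [Group K] in
lemma exists_integral_bilin [MeasurableSpace K] {μ : Measure K} (B : K → E →L[ℝ] E →L[ℝ] ℝ)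
    (hB : ∀ u v, Integrable (fun k => B k u v) μ) :
    ∃ b : E →L[ℝ] E →L[ℝ] ℝ, ∀ u v, b u v = ∫ k, B k u v ∂μ := by
  let b : E →ₗ[ℝ] E →ₗ[ℝ] ℝ := LinearMap.mk₂ ℝ (fun u v => ∫ k, B k u v ∂μ)
    (fun u u' v => by
      simp only [map_add, add_apply]
      exact integral_add (hB u v) (hB u' v))
    (fun c u v => by
      simp only [map_smul, smul_apply]
      exact integral_smul c _)
    (fun u v v' => by
      simp only [map_add]
      exact integral_add (hB u v) (hB u v'))
    (fun c u v => by
      simp only [map_smul]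
      exact integral_smul c _)
  exact ⟨LinearMap.toContinuousLinearMap
    ((LinearMap.toContinuousLinearMap (E := E) (F' := ℝ) (𝕜 := ℝ)).toLinearMap ∘ₗ b),
    fun u v => rfl⟩

variable [CompactSpace K] [MeasurableSpace K] [BorelSpace K]

lemma exists_averageForm
    (hs : ContMDiff (IK.prod I) I ∞ (fun p : K × M => p.1 • p.2))
    (μ : Measure K) [IsFiniteMeasure μ] (g : RiemannianMetric I M) (x : M) :
    ∃ b : TangentSpace I x →L[ℝ] TangentSpace I x →L[ℝ] ℝ, ∀ u v, b u v =
      ∫ k : K, pullbackForm (I := I) g (fun y : M => k • y) x u v ∂μ :=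
  exists_integral_bilin (E := E) _ fun u v =>
    (continuous_pullback_smul hs g x u v).integrable_of_hasCompactSupport
      (HasCompactSupport.of_compactSpace _)

lemma contMDiffAt_average [I.Boundaryless]
    (hs : ContMDiff (IK.prod I) I ∞ (fun p : K × M => p.1 • p.2))
    (μ : Measure K) [IsFiniteMeasure μ] (g : RiemannianMetric I M) (x₀ : M) (u v : E) :
    ContMDiffAt I 𝓘(ℝ) ∞
      (fun x => ∫ k : K, pullbackForm (I := I) g (fun y : M => k • y) x (frame I x₀ u x)
        (frame I x₀ v x) ∂μ) x₀ := by
  let φ := extChartAt I x₀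
  let f : K → E → ℝ := fun k y => pullbackForm (I := I) g (fun y : M => k • y) (φ.symm y)
    (frame I x₀ u (φ.symm y)) (frame I x₀ v (φ.symm y))
  have hf : ContMDiffOn (IK.prod 𝓘(ℝ, E)) 𝓘(ℝ) ∞ (Function.uncurry f) (univ ×ˢ φ.target) := by
    rintro ⟨k, y⟩ ⟨-, hy⟩
    have h1 : φ.symm y ∈ (trivializationAt E (TangentSpace I : M → Type _) x₀).baseSet := by
      rw [TangentBundle.trivializationAt_baseSet, ← extChartAt_source I]
      exact φ.map_target hy
    have h2 : ContMDiffAt 𝓘(ℝ, E) I ∞ φ.symm y :=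
      (contMDiffOn_extChartAt_symm x₀).contMDiffAt ((isOpen_extChartAt_target x₀).mem_nhds hy)
    exact ((contMDiffAt_pullback_smul hs g x₀ u v k h1).comp
      (f := fun p : K × E => (p.1, φ.symm p.2)) (k, y)
      (contMDiffAt_fst.prodMk (h2.comp (k, y) contMDiffAt_snd))).contMDiffWithinAt
  have h := contDiffOn_integral_param μ (isOpen_extChartAt_target x₀) hf
  have h3 : ContMDiffAt I 𝓘(ℝ) ∞ ((fun y => ∫ k, f k y ∂μ) ∘ φ) x₀ :=
    ((h.contDiffAt ((isOpen_extChartAt_target x₀).mem_nhds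
      (mem_extChartAt_target x₀))).contMDiffAt).comp x₀ contMDiffAt_extChartAt
  refine h3.congr_of_eventuallyEq ?_
  filter_upwards [extChartAt_source_mem_nhds (I := I) x₀] with x hx
  simp only [Function.comp, f]
  rw [φ.left_inv hx]

/-- A compact group acting smoothly on a manifold preserves some Riemannian metric. -/
theorem exists_invariantMetric [I.Boundaryless] [SigmaCompactSpace M] [T2Space M]
    [IsTopologicalGroup K]
    (hs : ContMDiff (IK.prod I) I ∞ (fun p : K × M => p.1 • p.2)) :
    ∃ g : RiemannianMetric I M, IsInvariantMetric I K g := by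
  obtain ⟨g⟩ := exists_riemannianMetric I M
  -- the inverse of a left-invariant measure is right-invariant
  let μ : Measure K := (Measure.haar : Measure K).inv
  have hsk : ∀ k : K, ContMDiff I I ∞ (fun y : M => k • y) := fun k =>
    hs.comp (f := fun y : M => (k, y)) (contMDiff_const.prodMk contMDiff_id)
  have hsd : ∀ (k : K) (x : M), MDifferentiableAt I I (fun y : M => k • y) x := fun k x =>
    (hsk k).mdifferentiableAt (by simp)
  have hcomp : ∀ (k a : K) (x : M) (v : TangentSpace I x),
      mfderiv I I (fun y : M => (k * a) • y) x v =
        mfderiv I I (fun y : M => k • y) (a • x) (mfderiv I I (fun y : M => a • y) x v) := by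
    intro k a x v
    have : (fun y : M => (k * a) • y) = (fun y : M => k • y) ∘ (fun y : M => a • y) := by
      ext y; exact mul_smul _ _ _
    rw [this, mfderiv_comp x (hsd k (a • x)) (hsd a x)]
    rfl
  choose b hb using exists_averageForm hs μ g
  have hp : ∀ (k : K) (x : M) (v : TangentSpace I x), v ≠ 0 →
      0 < pullbackForm (I := I) g (fun y : M => k • y) x v v := by
    intro k x v hv
    refine g.pos _ _ fun h0 => hv ?_
    have h1 := hcomp k⁻¹ k x v
    have h2 : (fun y : M => (k⁻¹ * k) • y) = id := by
      ext y
      simp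
    rw [h2, mfderiv_id] at h1
    exact h1.trans ((congrArg _ h0).trans (map_zero _))
  refine ⟨mkMetric b (fun x v w => ?_) (fun x v hv => ?_) (fun x₀ =>
    contMDiffAt_of_frame _ x₀ fun u v => by
      simp only [hb]
      exact contMDiffAt_average hs μ g x₀ u v),
    fun a x v w => ?_⟩
  · simp only [hb, pullbackForm_apply]
    simp only [g.symm]
  · rw [hb]
    refine (continuous_pullback_smul hs g x v v).integral_pos_of_hasCompactSupport_nonneg_nonzero
      (HasCompactSupport.of_compactSpace _) (fun k => (hp k x v hv).le) (x := 1) (hp 1 x v hv).ne'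
  · change b _ _ _ = b _ _ _
    rw [hb, hb, ← integral_mul_right_eq_self
      (fun k : K => pullbackForm (I := I) g (fun y : M => k • y) x v w) a]
    refine integral_congr_ae (Filter.Eventually.of_forall fun k => ?_)
    simp only [pullbackForm_apply]
    rw [hcomp, hcomp, mul_smul]

end Average

/-! ### Differentials, metrics and local sections on model spaces -/

section Quotient

variable {EP HP : Type*} [NormedAddCommGroup EP] [NormedSpace ℝ EP] [TopologicalSpace HP]
  {IP : ModelWithCorners ℝ EP HP}
  {P : Type*} [TopologicalSpace P] [ChartedSpace HP P]
  {EM HM : Type*} [NormedAddCommGroup EM] [NormedSpace ℝ EM] [TopologicalSpace HM]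
  {IM : ModelWithCorners ℝ EM HM}
  {M : Type*} [TopologicalSpace M] [ChartedSpace HM M]

variable (IP IM) in
/-- The differential of `f` at `p` as a map between the model vector spaces, which are the tangent
spaces by definition. -/
def modelDeriv (f : P → M) (p : P) : EP →L[ℝ] EM := mfderiv IP IM f p

/-- The scalar product of `g` at `p` as a form on the model vector space, which is the tangent space
by definition. -/
def modelForm [IsManifold IP ∞ P] (g : RiemannianMetric IP P) (p : P) : EP →L[ℝ] EP →L[ℝ] ℝ :=
  g.inner p

lemma modelForm_symm [IsManifold IP ∞ P] (g : RiemannianMetric IP P) (p : P) (v w : EP) :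
    modelForm g p v w = modelForm g p w v := g.symm p v w

lemma modelForm_pos [IsManifold IP ∞ P] (g : RiemannianMetric IP P) (p : P) (v : EP) (hv : v ≠ 0) :
    0 < modelForm g p v v := g.pos p v hv

lemma modelDeriv_comp {E' H' N : Type*} [NormedAddCommGroup E'] [NormedSpace ℝ E']
    [TopologicalSpace H'] {I' : ModelWithCorners ℝ E' H'} [TopologicalSpace N] [ChartedSpace H' N]
    {g : M → N} {f : P → M} (p : P) (hg : MDifferentiableAt IM I' g (f p))
    (hf : MDifferentiableAt IP IM f p) :
    modelDeriv IP I' (g ∘ f) p = modelDeriv IM I' g (f p) ∘L modelDeriv IP IM f p :=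
  mfderiv_comp p hg hf

lemma modelDeriv_id (p : P) : modelDeriv IP IP (id : P → P) p = ContinuousLinearMap.id ℝ EP :=
  mfderiv_id

lemma hasFDerivAt_writtenInExtChartAt [IP.Boundaryless] {f : P → M} {p : P}
    (hf : MDifferentiableAt IP IM f p) :
    HasFDerivAt (writtenInExtChartAt IP IM p f) (modelDeriv IP IM f p) (extChartAt IP p p) := by
  have h1 : HasFDerivWithinAt (writtenInExtChartAt IP IM p f) (modelDeriv IP IM f p)
    (Set.range IP) (extChartAt IP p p) := hf.hasMFDerivAt.2
  rwa [IP.range_eq_univ, hasFDerivWithinAt_univ] at h1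

/-- Every right inverse `L` of the differential of `f` at `p` is the differential of a local section
of `f` through `p`. -/
lemma exists_local_section [FiniteDimensional ℝ EM] [IP.Boundaryless] [IM.Boundaryless]
    [IsManifold IP ∞ P] [IsManifold IM ∞ M] {f : P → M} {p : P}
    (hf : ContMDiffAt IP IM ∞ f p) (L : EM →L[ℝ] EP) (hL : ∀ w : EM, modelDeriv IP IM f p (L w) = w) :
    ∃ s : M → P, ContMDiffAt IM IP ∞ s (f p) ∧ s (f p) = p ∧ (∀ᶠ x in 𝓝 (f p), f (s x) = x) ∧
      modelDeriv IM IP s (f p) = L := by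
  have : CompleteSpace EM := FiniteDimensional.complete ℝ EM
  let φ := extChartAt IP p
  let ψ := extChartAt IM (f p)
  let j : EM → EP := fun u => φ p + L u
  have hj0 : j 0 = φ p := by simp [j]
  have hj : ContDiff ℝ ∞ j := by fun_prop
  have hφs : ContMDiffAt 𝓘(ℝ, EP) IP ∞ φ.symm (φ p) :=
    (contMDiffOn_extChartAt_symm p).contMDiffAt
      ((isOpen_extChartAt_target p).mem_nhds (mem_extChartAt_target p))
  have hφp : φ.symm (φ p) = p := φ.left_inv (mem_extChartAt_source p)
  have hψ : ContMDiffAt IM 𝓘(ℝ, EM) ∞ ψ (f p) := contMDiffAt_extChartAt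
  -- the inverse function theorem is applied to `k`, which is `f` in charts on the affine subspace
  -- through `p` with direction the range of `L`
  let k : EM → EM := fun u => ψ (f (φ.symm (j u)))
  have hk0 : k 0 = ψ (f p) := by simp only [k, hj0, hφp]
  have hfp : ContMDiffAt IP IM ∞ f (φ.symm (j 0)) := by rwa [hj0, hφp]
  have hφj : ContMDiffAt 𝓘(ℝ, EM) IP ∞ (fun u => φ.symm (j u)) 0 :=
    ContMDiffAt.comp (g := φ.symm) (f := j) 0 (by rwa [hj0]) hj.contMDiff.contMDiffAt
  have hfj : ContMDiffAt 𝓘(ℝ, EM) IM ∞ (fun u => f (φ.symm (j u))) 0 :=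
    ContMDiffAt.comp (g := f) 0 hfp hφj
  have hkc : ContDiffAt ℝ ∞ k 0 :=
    (ContMDiffAt.comp (g := ψ) (f := fun u => f (φ.symm (j u))) 0
      (by rwa [hj0, hφp]) hfj).contDiffAt
  have hkd : HasFDerivAt k ((ContinuousLinearEquiv.refl ℝ EM : EM ≃L[ℝ] EM) : EM →L[ℝ] EM) 0 := by
    have h1 := hasFDerivAt_writtenInExtChartAt (hf.mdifferentiableAt (by simp))
    have h2 : HasFDerivAt j L 0 := (L.hasFDerivAt).const_add (φ p)
    have h3 : HasFDerivAt (fun y => ψ (f (φ.symm y))) (modelDeriv IP IM f p) (j 0) := by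
      rw [hj0]
      exact h1
    have h4 := h3.comp 0 h2
    have h5 : (modelDeriv IP IM f p) ∘L L
        = ((ContinuousLinearEquiv.refl ℝ EM : EM ≃L[ℝ] EM) : EM →L[ℝ] EM) := by
      ext w
      exact hL w
    rwa [h5] at h4
  let i := hkc.localInverse hkd (by simp)
  have hi : ContDiffAt ℝ ∞ i (ψ (f p)) := by
    have := hkc.to_localInverse hkd (by simp)
    rwa [hk0] at this
  have hi0 : i (ψ (f p)) = 0 := by
    rw [← hk0]
    exact hkc.localInverse_apply_image hkd (by simp)
  have hik : ∀ᶠ y in 𝓝 (ψ (f p)), k (i y) = y := by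
    rw [← hk0]
    exact (hkc.hasStrictFDerivAt' hkd (by simp)).eventually_right_inverse
  have hid : HasFDerivAt i (ContinuousLinearMap.id ℝ EM) (ψ (f p)) := by
    rw [← hk0]
    exact (hkc.hasStrictFDerivAt' hkd (by simp)).to_localInverse.hasFDerivAt
  have hiψ : ContMDiffAt IM 𝓘(ℝ, EM) ∞ (fun x => i (ψ x)) (f p) :=
    ContMDiffAt.comp (g := i) (f p) hi.contMDiffAt hψ
  have hs : ContMDiffAt IM IP ∞ (fun x => φ.symm (j (i (ψ x)))) (f p) :=
    ContMDiffAt.comp (g := fun u => φ.symm (j u)) (f p) (by rwa [hi0]) hiψ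
  have hs0 : φ.symm (j (i (ψ (f p)))) = p := by rw [hi0, hj0, hφp]
  refine ⟨fun x => φ.symm (j (i (ψ x))), hs, hs0, ?_, ?_⟩
  · have h1 : ∀ᶠ x in 𝓝 (f p), f (φ.symm (j (i (ψ x)))) ∈ ψ.source := by
      have h2 : ContinuousAt (fun x => f (φ.symm (j (i (ψ x))))) (f p) :=
        (ContMDiffAt.comp (g := f) (f p) (by rwa [hs0]) hs).continuousAt
      refine h2.eventually ?_
      simp only [hs0]
      exact extChartAt_source_mem_nhds (I := IM) (f p)
    filter_upwards [h1, hψ.continuousAt.eventually hik,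
      extChartAt_source_mem_nhds (I := IM) (f p)] with x hx1 hx2 hx3
    exact ψ.injOn hx1 hx3 hx2
  · have h1 := hasFDerivAt_writtenInExtChartAt (hs.mdifferentiableAt (by simp))
    have h2 : HasFDerivAt (fun y => j (i y)) (L ∘L ContinuousLinearMap.id ℝ EM) (ψ (f p)) :=
      ((L.hasFDerivAt).const_add (φ p)).comp (ψ (f p)) hid
    have h3 : writtenInExtChartAt IM IP (f p) (fun x => φ.symm (j (i (ψ x))))
        =ᶠ[𝓝 (ψ (f p))] fun y => j (i y) := by
      have hc : ContinuousAt (fun y => j (i y)) (ψ (f p)) := h2.continuousAt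
      have h4 : ∀ᶠ y in 𝓝 (ψ (f p)), j (i y) ∈ φ.target := by
        refine hc.eventually ?_
        simp only [hi0, hj0]
        exact (isOpen_extChartAt_target p).mem_nhds (mem_extChartAt_target p)
      filter_upwards [h4, (isOpen_extChartAt_target (I := IM) (f p)).mem_nhds
        (mem_extChartAt_target (f p))] with y hy1 hy2
      simp only [writtenInExtChartAt, Function.comp_apply]
      rw [hs0, ψ.right_inv hy2, φ.right_inv hy1]
    exact (h1.congr_of_eventuallyEq h3.symm).unique h2

variable {K : Type*} [Group K] [MulAction K P]

lemma modelDeriv_smul {f : P → M} (hf : ContMDiff IP IM ∞ f) {k : K}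
    (hk : ContMDiff IP IP ∞ fun p : P => k • p) {ψ : M → M} (hψ : MDifferentiable IM IM ψ)
    (hfk : ∀ p, f (k • p) = ψ (f p)) (p : P) :
    modelDeriv IP IM f (k • p) ∘L modelDeriv IP IP (fun p : P => k • p) p
      = modelDeriv IM IM ψ (f p) ∘L modelDeriv IP IM f p := by
  have h1 := modelDeriv_comp p (hf.mdifferentiableAt (x := k • p) (by simp))
    (hk.mdifferentiableAt (x := p) (by simp))
  have h2 := modelDeriv_comp p (hψ (f p)) (hf.mdifferentiableAt (x := p) (by simp))
  have h3 : f ∘ (fun p : P => k • p) = ψ ∘ f := funext hfk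
  rw [h3] at h1
  exact h1.symm.trans h2

lemma modelDeriv_smul_inv (hk : ∀ k : K, ContMDiff IP IP ∞ fun p : P => k • p) (k : K) (p : P) :
    modelDeriv IP IP (fun p : P => k • p) p ∘L
      modelDeriv IP IP (fun p : P => k⁻¹ • p) (k • p) = ContinuousLinearMap.id ℝ EP := by
  have h1 := modelDeriv_comp (k • p) (g := fun p : P => k • p) (f := fun p : P => k⁻¹ • p)
    ((hk k).mdifferentiableAt (by simp)) ((hk k⁻¹).mdifferentiableAt (by simp))
  have h2 : (fun p : P => k • p) ∘ (fun p : P => k⁻¹ • p) = id := by ext; simp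
  simp only [h2, modelDeriv_id, inv_smul_smul] at h1
  exact h1.symm

/-- If an isometry `k` of `P` covers the map `ψ` of `M`, then `ψ` preserves quotient forms. -/
lemma quotientForm_smul_eq [IsManifold IP ∞ P] {g : RiemannianMetric IP P}
    (hg : IsInvariantMetric IP K g) {f : P → M} (hf : ContMDiff IP IM ∞ f) {k : K}
    (hk : ∀ k : K, ContMDiff IP IP ∞ fun p : P => k • p) {ψ : M → M}
    (hψ : MDifferentiable IM IM ψ) (hfk : ∀ p, f (k • p) = ψ (f p)) {p : P}
    (hinj : Function.Injective (modelDeriv IM IM ψ (f p))) {q q' : EM → EM → ℝ}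
    (hq : IsQuotientForm (fun v w => modelForm g p v w) (modelDeriv IP IM f p) q)
    (hq' : IsQuotientForm (fun v w => modelForm g (k • p) v w) (modelDeriv IP IM f (k • p)) q')
    (u v : EM) :
    q' (modelDeriv IM IM ψ (f p) u) (modelDeriv IM IM ψ (f p) v) = q u v := by
  have hqs := hq.symm (modelForm_symm g p)
  obtain ⟨h, h1, h2⟩ := hq
  obtain ⟨h', h1', h2'⟩ := hq'
  have hd := fun v => congrArg (fun A : EP →L[ℝ] EM => A v) (modelDeriv_smul hf (hk k) hψ hfk p)
  simp only [ContinuousLinearMap.comp_apply] at hd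
  obtain ⟨y, hy⟩ : ∃ y, modelDeriv IP IP (fun p : P => k • p) p y
      = h' (modelDeriv IM IM ψ (f p) u) :=
    ⟨_, congrArg (fun A : EP →L[ℝ] EP => A _) (modelDeriv_smul_inv (IP := IP) hk k p)⟩
  have hy' : modelDeriv IP IM f p y = u := by
    apply hinj
    rw [← hd, hy, h1']
  have hg' : modelForm g (k • p) (modelDeriv IP IP (fun p : P => k • p) p y)
    (modelDeriv IP IP (fun p : P => k • p) p (h v)) = modelForm g p y (h v) := hg k p y (h v)
  have e1 := h2' (modelDeriv IM IM ψ (f p) u) (modelDeriv IP IP (fun p : P => k • p) p (h v))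
  have e2 := h2 v y
  simp only [hd, h1, hy'] at e1 e2
  rw [← e1, ← hy, hg', modelForm_symm, e2, hqs]

end Quotient

/-! ### Quotient metrics -/

section Quotient

variable {EP HP : Type*} [NormedAddCommGroup EP] [NormedSpace ℝ EP] [TopologicalSpace HP]
  {IP : ModelWithCorners ℝ EP HP}
  {P : Type*} [TopologicalSpace P] [ChartedSpace HP P] [IsManifold IP ∞ P]
  {EM HM : Type*} [NormedAddCommGroup EM] [NormedSpace ℝ EM] [TopologicalSpace HM]
  {IM : ModelWithCorners ℝ EM HM}
  {M : Type*} [TopologicalSpace M] [ChartedSpace HM M] [IsManifold IM ∞ M]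

variable (IP) in
/-- The values at `p` of the frames of the chart at `p₀`, as an endomorphism of the model vector
space. -/
def modelFrame (p₀ p : P) : EP →L[ℝ] EP :=
  (trivializationAt EP (TangentSpace IP) p₀).symmL ℝ p

lemma exists_equiv_modelFrame {p₀ p : P}
    (hp : p ∈ (trivializationAt EP (TangentSpace IP : P → Type _) p₀).baseSet) :
    ∃ e : EP ≃L[ℝ] EP, (e : EP →L[ℝ] EP) = modelFrame IP p₀ p :=
  ⟨((trivializationAt EP (TangentSpace IP : P → Type _) p₀).continuousLinearEquivAt ℝ p hp).symm,
    ContinuousLinearMap.ext fun v => congrFun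
      (Bundle.Trivialization.symm_continuousLinearEquivAt_eq (R := ℝ) _ hp) v⟩

/-- The form of the metric `g` at `p` in the chart at `p₀`. -/
def coordForm (g : RiemannianMetric IP P) (p₀ p : P) : EP →L[ℝ] EP →L[ℝ] ℝ :=
  ContinuousLinearMap.precomp ℝ (modelFrame IP p₀ p) ∘L modelForm g p ∘L modelFrame IP p₀ p

lemma coordForm_apply (g : RiemannianMetric IP P) (p₀ p : P) (u v : EP) :
    coordForm g p₀ p u v = modelForm g p (modelFrame IP p₀ p u) (modelFrame IP p₀ p v) := rfl

lemma coordForm_pos (g : RiemannianMetric IP P) {p₀ p : P}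
    (hp : p ∈ (trivializationAt EP (TangentSpace IP : P → Type _) p₀).baseSet)
    (v : EP) (hv : v ≠ 0) : 0 < coordForm g p₀ p v v := by
  obtain ⟨e, he⟩ := exists_equiv_modelFrame hp
  rw [coordForm_apply, ← he]
  refine modelForm_pos g p _ ?_
  simpa using hv

lemma contMDiffAt_coordForm [FiniteDimensional ℝ EP] (g : RiemannianMetric IP P) (p₀ : P) :
    ContMDiffAt IP 𝓘(ℝ, EP →L[ℝ] EP →L[ℝ] ℝ) ∞ (coordForm g p₀) p₀ := by
  refine contMDiffAt_clm_of_apply fun u => contMDiffAt_clm_of_apply fun v => ?_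
  exact contMDiffAt_inner g (contMDiffAt_frame p₀ u (mem_baseSet_self p₀))
    (contMDiffAt_frame p₀ v (mem_baseSet_self p₀))

variable (IP IM) in
/-- The differential of `f` at `p` in the charts at `p₀` and `f p₀`. -/
def coordDeriv (f : P → M) (p₀ p : P) : EP →L[ℝ] EM :=
  inTangentCoordinates IP IM id f (modelDeriv IP IM f) p₀ p

lemma contMDiffAt_coordDeriv {f : P → M} {p₀ : P} (hf : ContMDiffAt IP IM ∞ f p₀) :
    ContMDiffAt IP 𝓘(ℝ, EP →L[ℝ] EM) ∞ (coordDeriv IP IM f p₀) p₀ :=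
  hf.mfderiv_const le_rfl

lemma modelFrame_coordDeriv {f : P → M} {p₀ p : P}
    (hf : f p ∈ (trivializationAt EM (TangentSpace IM : M → Type _) (f p₀)).baseSet) (v : EP) :
    modelFrame IM (f p₀) (f p) (coordDeriv IP IM f p₀ p v)
      = modelDeriv IP IM f p (modelFrame IP p₀ p v) :=
  Bundle.Trivialization.symmL_continuousLinearMapAt _ hf _

/-- A family `Q` of quotient forms of the metric `g` along `f` is smooth in the charts. -/
lemma contMDiffAt_quotient [FiniteDimensional ℝ EP] [FiniteDimensional ℝ EM]
    (g : RiemannianMetric IP P) {f : P → M} (hf : ContMDiff IP IM ∞ f)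
    (hd : ∀ p, Function.Surjective (modelDeriv IP IM f p)) {Q : M → EM →L[ℝ] EM →L[ℝ] ℝ}
    (hQ : ∀ p, IsQuotientForm (fun v w => modelForm g p v w) (modelDeriv IP IM f p)
      (fun v w => Q (f p) v w)) (p₀ : P) (u v : EM) :
    ContMDiffAt IP 𝓘(ℝ) ∞ (fun p => Q (f p) (modelFrame IM (f p₀) (f p) u)
      (modelFrame IM (f p₀) (f p) v)) p₀ := by
  have hbase : ∀ᶠ p in 𝓝 p₀,
      f p ∈ (trivializationAt EM (TangentSpace IM : M → Type _) (f p₀)).baseSet :=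
    hf.continuous.continuousAt.eventually (eventually_mem_baseSet (f p₀))
  have hsurj : ∀ p, p ∈ (trivializationAt EP (TangentSpace IP : P → Type _) p₀).baseSet →
      f p ∈ (trivializationAt EM (TangentSpace IM : M → Type _) (f p₀)).baseSet →
      Function.Surjective (coordDeriv IP IM f p₀ p) := by
    intro p hp hp' w
    obtain ⟨e, he⟩ := exists_equiv_modelFrame hp
    obtain ⟨e', he'⟩ := exists_equiv_modelFrame hp'
    obtain ⟨v, hv⟩ := hd p (e' w)
    refine ⟨e.symm v, e'.injective ?_⟩
    have h1 := modelFrame_coordDeriv (IP := IP) hp' (e.symm v)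
    rw [← he, ← he'] at h1
    simpa [hv] using h1
  have h1 : ContMDiffAt IP 𝓘(ℝ, EM →L[ℝ] EM →L[ℝ] ℝ) ∞
      (fun p => quotientForm (coordForm g p₀ p) (coordDeriv IP IM f p₀ p)) p₀ :=
    ContMDiffAt.comp (g := fun q : (EP →L[ℝ] EP →L[ℝ] ℝ) × (EP →L[ℝ] EM) =>
      quotientForm q.1 q.2) (f := fun p => (coordForm g p₀ p, coordDeriv IP IM f p₀ p)) p₀
      (contDiffAt_quotientForm (coordForm_pos g (mem_baseSet_self p₀))
        (hsurj p₀ (mem_baseSet_self p₀) (mem_baseSet_self _))).contMDiffAt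
      ((contMDiffAt_coordForm g p₀).prodMk_space (contMDiffAt_coordDeriv hf.contMDiffAt))
  have h2 : ContMDiffAt IP 𝓘(ℝ) ∞
      (fun p => quotientForm (coordForm g p₀ p) (coordDeriv IP IM f p₀ p) u v) p₀ :=
    (h1.clm_apply contMDiffAt_const).clm_apply contMDiffAt_const
  refine h2.congr_of_eventuallyEq ?_
  filter_upwards [hbase, eventually_mem_baseSet (I := IP) p₀] with p hp hp'
  obtain ⟨e, he⟩ := exists_equiv_modelFrame hp'
  obtain ⟨e', he'⟩ := exists_equiv_modelFrame hp
  have h3 : IsQuotientForm (fun v w => coordForm g p₀ p v w) (coordDeriv IP IM f p₀ p)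
      (fun v w => Q (f p) (modelFrame IM (f p₀) (f p) v) (modelFrame IM (f p₀) (f p) w)) := by
    refine (hQ p).congr e.symm.toLinearEquiv e'.symm.toLinearEquiv (fun v w => ?_) (fun v => ?_)
      (fun v w => ?_)
    · rw [coordForm_apply, ← he]
      simp
    · apply e'.injective
      have h4 := modelFrame_coordDeriv (IP := IP) hp (e.symm v)
      rw [← he, ← he'] at h4
      simpa using h4
    · rw [← he']
      simp
  have h5 := isQuotientForm_quotientForm (coordForm_pos g hp') (hsurj p hp' hp)
  have h6 := h3.unique h5 (fun v w => by simp only [coordForm_apply, modelForm_symm g p])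
  exact congrFun (congrFun h6 u) v

/-- Let a group `K` act on `P` by isometries, transitively on the fibres of the submersion `f`
by maps over `M`. Then the metric of `P` has a quotient metric on `M`. -/
theorem exists_quotientMetric [IP.Boundaryless] [IM.Boundaryless]
    [FiniteDimensional ℝ EP] [FiniteDimensional ℝ EM]
    {K : Type*} [Group K] [MulAction K P] (hk : ∀ k : K, ContMDiff IP IP ∞ fun p : P => k • p)
    {g : RiemannianMetric IP P} (hg : IsInvariantMetric IP K g)
    {f : P → M} (hf : ContMDiff IP IM ∞ f) (hsurj : Function.Surjective f)
    (hd : ∀ p, Function.Surjective (modelDeriv IP IM f p))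
    (hfib : ∀ p p', f p = f p' → ∃ k : K, k • p = p' ∧ ∀ y, f (k • y) = f y) :
    ∃ q : RiemannianMetric IM M, ∀ p, IsQuotientForm (fun v w => modelForm g p v w)
      (modelDeriv IP IM f p) (fun v w => modelForm q (f p) v w) := by
  let σ : M → P := Function.surjInv hsurj
  let Q : M → EM →L[ℝ] EM →L[ℝ] ℝ := fun x =>
    quotientForm (modelForm g (σ x)) (modelDeriv IP IM f (σ x))
  have hQ0 : ∀ p, IsQuotientForm (fun v w => modelForm g p v w) (modelDeriv IP IM f p)
      (fun v w => quotientForm (modelForm g p) (modelDeriv IP IM f p) v w) := fun p =>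
    isQuotientForm_quotientForm (modelForm_pos g p) (hd p)
  -- by transitivity on the fibres, `Q` does not depend on the choice of the points `σ x`
  have hQ : ∀ p, IsQuotientForm (fun v w => modelForm g p v w) (modelDeriv IP IM f p)
      (fun v w => Q (f p) v w) := by
    intro p
    obtain ⟨k, hkp, hkf⟩ := hfib (σ (f p)) p (Function.surjInv_eq hsurj _)
    have h1 := quotientForm_smul_eq hg hf hk (k := k) (ψ := id) mdifferentiable_id hkf
      (p := σ (f p)) (by rw [modelDeriv_id]; exact Function.injective_id)
      (hQ0 _) (hQ0 _)
    simp only [modelDeriv_id, ContinuousLinearMap.id_apply] at h1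
    have h2 := hQ0 p
    rw [← hkp] at h2 ⊢
    simp only [h1] at h2
    rw [hkf]
    have h3 : f (σ (f p)) = f p := Function.surjInv_eq hsurj _
    rwa [h3]
  have hs : ∀ x v w, Q x v w = Q x w v := by
    intro x v w
    obtain ⟨p, rfl⟩ := hsurj x
    exact (hQ p).symm (modelForm_symm g p) v w
  have hp : ∀ x v, v ≠ 0 → 0 < Q x v v := by
    intro x v hv
    obtain ⟨p, rfl⟩ := hsurj x
    exact (hQ p).pos (modelForm_pos g p) (map_zero _) v hv
  refine ⟨mkMetric Q hs hp fun x₀ => contMDiffAt_of_frame _ x₀ fun u v => ?_, hQ⟩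
  obtain ⟨p₀, rfl⟩ := hsurj x₀
  obtain ⟨h, h1, -⟩ := hQ p₀
  obtain ⟨s, hs, hs0, hfs, -⟩ := exists_local_section hf.contMDiffAt
    (LinearMap.toContinuousLinearMap h) h1
  have h2 := ContMDiffAt.comp (f p₀) (by rw [hs0]; exact contMDiffAt_quotient g hf hd hQ p₀ u v) hs
  refine h2.congr_of_eventuallyEq ?_
  filter_upwards [hfs] with x hx
  simp only [Function.comp_apply, hx]
  rfl

end Quotient

/-! ### Metrics with a given quotient -/

section Quotient

variable {EP HP : Type*} [NormedAddCommGroup EP] [NormedSpace ℝ EP] [TopologicalSpace HP]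
  {IP : ModelWithCorners ℝ EP HP}
  {P : Type*} [TopologicalSpace P] [ChartedSpace HP P] [IsManifold IP ∞ P]
  {EM HM : Type*} [NormedAddCommGroup EM] [NormedSpace ℝ EM] [TopologicalSpace HM]
  {IM : ModelWithCorners ℝ EM HM}
  {M : Type*} [TopologicalSpace M] [ChartedSpace HM M] [IsManifold IM ∞ M]

/-- The metric `g` on `P` with quotient `q` on `M` can be changed on horizontal vectors so that its
quotient becomes a given metric `gM`. -/
theorem exists_metric_with_quotient [FiniteDimensional ℝ EP]
    (g : RiemannianMetric IP P) {f : P → M} (hf : ContMDiff IP IM ∞ f) (q gM : RiemannianMetric IM M)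
    (hq : ∀ p, IsQuotientForm (fun v w => modelForm g p v w) (modelDeriv IP IM f p)
      (fun v w => modelForm q (f p) v w)) :
    ∃ g' : RiemannianMetric IP P,
      (∀ p v w, modelForm g' p v w = modelForm g p v w
        + modelForm gM (f p) (modelDeriv IP IM f p v) (modelDeriv IP IM f p w)
        - modelForm q (f p) (modelDeriv IP IM f p v) (modelDeriv IP IM f p w)) ∧
      ∀ p, IsQuotientForm (fun v w => modelForm g' p v w) (modelDeriv IP IM f p)
        (fun v w => modelForm gM (f p) v w) := by
  let D := modelDeriv IP IM f
  let b : P → EP →L[ℝ] EP →L[ℝ] ℝ := fun p => modelForm g p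
    + ContinuousLinearMap.precomp ℝ (D p) ∘L modelForm gM (f p) ∘L D p
    - ContinuousLinearMap.precomp ℝ (D p) ∘L modelForm q (f p) ∘L D p
  have hb : ∀ p v w, b p v w = modelForm g p v w + modelForm gM (f p) (D p v) (D p w)
    - modelForm q (f p) (D p v) (D p w) := fun p v w => rfl
  have hsymm : ∀ p v w, b p v w = b p w v := by
    intro p v w
    rw [hb, hb, modelForm_symm g, modelForm_symm gM, modelForm_symm q]
  -- `q` cancels against the horizontal part of `g`, and the vertical part `u` of `v` remains
  have hpos : ∀ p v, v ≠ 0 → 0 < b p v v := by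
    intro p v hv
    obtain ⟨u, hu, hu'⟩ := (hq p).exists_vertical (modelForm_symm g p) v
    have h1 : b p v v = modelForm gM (f p) (D p v) (D p v) + modelForm g p u u := by
      rw [hb, hu]
      ring
    rw [h1]
    by_cases hD : D p v = 0
    · have : u ≠ 0 := fun h0 => hv (hu' h0 hD)
      simpa [hD] using modelForm_pos g p u this
    · have h2 := modelForm_pos gM (f p) _ hD
      by_cases h0 : u = 0
      · simpa [h0] using h2
      · exact add_pos h2 (modelForm_pos g p u h0)
  refine ⟨mkMetric b hsymm hpos fun p₀ => contMDiffAt_of_frame _ p₀ fun u v => ?_, hb, fun p => ?_⟩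
  · have hF := fun u : EP => contMDiffAt_frame (I := IP) p₀ u (mem_baseSet_self p₀)
    have hD := fun u : EP => contMDiffAt_mfderiv_frame (I' := IM) hf.contMDiffAt (hF u)
    exact ((contMDiffAt_inner g (hF u) (hF v)).add (contMDiffAt_inner gM (hD u) (hD v))).sub
      (contMDiffAt_inner q (hD u) (hD v))
  · obtain ⟨h, h1, h2⟩ := hq p
    refine ⟨h, h1, fun w v => ?_⟩
    have h3 : b p (h w) v = modelForm gM (f p) w (D p v) := by
      have h4 : modelForm g p (h w) v = modelForm q (f p) w (D p v) := h2 w v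
      have h5 : D p (h w) = w := h1 w
      rw [hb, h4, h5]
      ring
    exact h3

end Quotient

/-! ### Lengths of paths and Riemannian distances -/

section Distance

open MeasureTheory Set

variable {E H : Type*} [NormedAddCommGroup E] [NormedSpace ℝ E] [TopologicalSpace H]
  {I : ModelWithCorners ℝ E H}
  {M : Type*} [TopologicalSpace M] [ChartedSpace H M] [IsManifold I ∞ M]
  {E' H' : Type*} [NormedAddCommGroup E'] [NormedSpace ℝ E'] [TopologicalSpace H']
  {I' : ModelWithCorners ℝ E' H'}
  {N : Type*} [TopologicalSpace N] [ChartedSpace H' N] [IsManifold I' ∞ N]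

/-- The length of a tangent vector. -/
def metricENorm (g : RiemannianMetric I M) (x : M) (v : E) : ℝ≥0∞ :=
  ENNReal.ofReal √(modelForm g x v v)

/-- The length of the path `γ` on `[a, b]`. -/
def metricLength (g : RiemannianMetric I M) (γ : ℝ → M) (a b : ℝ) : ℝ≥0∞ :=
  ∫⁻ t in Icc a b, metricENorm g (γ t) (modelDeriv 𝓘(ℝ) I γ t 1)

lemma metricLength_add (g : RiemannianMetric I M) (γ : ℝ → M) {a b c : ℝ} (h : a ≤ b)
    (h' : b ≤ c) :
    metricLength g γ a b + metricLength g γ b c = metricLength g γ a c := by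
  unfold metricLength
  rw [← Icc_union_Ioc_eq_Icc h h', lintegral_union measurableSet_Ioc, restrict_Ioc_eq_restrict_Icc]
  exact Set.disjoint_left.2 fun t ht ht' => ht'.1.not_ge ht.2

section
open scoped Bundle
open Manifold

lemma pathELength_eq_metricLength (g : RiemannianMetric I M) (γ : ℝ → M) (a b : ℝ) :
    let _ : Bundle.RiemannianBundle (fun x : M => TangentSpace I x) := ⟨g.toRiemannianMetric⟩
    pathELength I γ a b = metricLength g γ a b := by
  let _ : Bundle.RiemannianBundle (fun x : M => TangentSpace I x) := ⟨g.toRiemannianMetric⟩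
  change pathELength I γ a b = metricLength g γ a b
  rw [pathELength_eq_lintegral_mfderiv_Icc]
  refine lintegral_congr fun t => ?_
  rw [← ofReal_norm, norm_eq_sqrt_real_inner]
  rfl

lemma metricEDist_le_metricLength (g : RiemannianMetric I M) {γ : ℝ → M} {a b : ℝ} (hab : a ≤ b)
    (hγ : ContMDiffOn 𝓘(ℝ) I 1 γ (Icc a b)) :
    metricEDist I g (γ a) (γ b) ≤ metricLength g γ a b := by
  let _ : Bundle.RiemannianBundle (fun x : M => TangentSpace I x) := ⟨g.toRiemannianMetric⟩
  rw [← pathELength_eq_metricLength]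
  exact riemannianEDist_le_pathELength hγ rfl rfl hab

lemma exists_metricLength_lt (g : RiemannianMetric I M) {x y : M} {r : ℝ≥0∞}
    (h : metricEDist I g x y < r) :
    ∃ γ : ℝ → M, γ 0 = x ∧ γ 1 = y ∧ ContMDiff 𝓘(ℝ) I 1 γ ∧ metricLength g γ 0 1 < r := by
  let _ : Bundle.RiemannianBundle (fun x : M => TangentSpace I x) := ⟨g.toRiemannianMetric⟩
  obtain ⟨γ, h0, h1, hγ, hl, -⟩ := exists_lt_locally_constant_of_riemannianEDist_lt h zero_lt_one
  exact ⟨γ, h0, h1, hγ, by rwa [← pathELength_eq_metricLength]⟩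

lemma metricEDist_self (g : RiemannianMetric I M) (x : M) : metricEDist I g x x = 0 := by
  let _ : Bundle.RiemannianBundle (fun x : M => TangentSpace I x) := ⟨g.toRiemannianMetric⟩
  exact riemannianEDist_self

lemma metricEDist_triangle (g : RiemannianMetric I M) (x y z : M) :
    metricEDist I g x z ≤ metricEDist I g x y + metricEDist I g y z := by
  let _ : Bundle.RiemannianBundle (fun x : M => TangentSpace I x) := ⟨g.toRiemannianMetric⟩
  exact riemannianEDist_triangle

end

/-- A map that stretches tangent vectors by at most `C` stretches the lengths of paths by at most
`C`. -/
lemma metricEDist_comp_le (g : RiemannianMetric I M) (g' : RiemannianMetric I' N) {φ : M → N}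
    {C : ℝ≥0∞} (hC : C ≠ ⊤) {γ : ℝ → M} (hγ : ContMDiff 𝓘(ℝ) I 1 γ) {a b : ℝ} (hab : a ≤ b)
    (hφ : ∀ t ∈ Icc a b, ContMDiffAt I I' 1 φ (γ t))
    (hle : ∀ t ∈ Icc a b, ∀ u,
      metricENorm g' (φ (γ t)) (modelDeriv I I' φ (γ t) u) ≤ C * metricENorm g (γ t) u) :
    metricEDist I' g' (φ (γ a)) (φ (γ b)) ≤ C * metricLength g γ a b := by
  refine (metricEDist_le_metricLength g' (γ := φ ∘ γ) hab fun t ht =>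
    ((hφ t ht).comp t hγ.contMDiffAt).contMDiffWithinAt).trans ?_
  unfold metricLength
  rw [← lintegral_const_mul' _ _ hC]
  refine setLIntegral_mono' measurableSet_Icc fun t ht => ?_
  rw [modelDeriv_comp t ((hφ t ht).mdifferentiableAt (by simp))
    (hγ.mdifferentiableAt (by simp))]
  exact hle t ht _

/-- Positivity of a form is an open condition. -/
lemma eventually_form_nonneg [FiniteDimensional ℝ E] {X : Type*} [TopologicalSpace X]
    {T : X → E →L[ℝ] E →L[ℝ] ℝ} {x₀ : X} (hT : ContinuousAt T x₀)
    (hpos : ∀ v, v ≠ 0 → 0 < T x₀ v v) : ∀ᶠ x in 𝓝 x₀, ∀ v, 0 ≤ T x v v := by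
  obtain ⟨c, hc, hcT⟩ := exists_coercive (T x₀) hpos
  have hT' : ∀ᶠ x in 𝓝 x₀, ‖T x - T x₀‖ < c := by
    filter_upwards [hT (Metric.ball_mem_nhds (T x₀) hc)] with x hx
    exact lt_of_eq_of_lt (dist_eq_norm (T x) (T x₀)).symm (show dist (T x) (T x₀) < c from hx)
  filter_upwards [hT'] with x hx v
  have h2 : |(T x - T x₀) v v| ≤ c * ‖v‖ ^ 2 := by
    calc |(T x - T x₀) v v| ≤ ‖T x - T x₀‖ * ‖v‖ * ‖v‖ := (T x - T x₀).le_opNorm₂ v v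
      _ ≤ c * ‖v‖ * ‖v‖ := by gcongr
      _ = _ := by ring
  have h3 : (T x - T x₀) v v = T x v v - T x₀ v v := rfl
  have h4 := (abs_le.1 h2).1
  linarith [hcT v]

end Distance

/-! ### Distances under Riemannian submersions -/

section Submersion

open Set

variable {EP HP : Type*} [NormedAddCommGroup EP] [NormedSpace ℝ EP] [TopologicalSpace HP]
  {IP : ModelWithCorners ℝ EP HP}
  {P : Type*} [TopologicalSpace P] [ChartedSpace HP P] [IsManifold IP ∞ P]
  {EM HM : Type*} [NormedAddCommGroup EM] [NormedSpace ℝ EM] [TopologicalSpace HM]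
  {IM : ModelWithCorners ℝ EM HM}
  {M : Type*} [TopologicalSpace M] [ChartedSpace HM M] [IsManifold IM ∞ M]

lemma metricENorm_le_of_form_le {g : RiemannianMetric IP P} {q : RiemannianMetric IM M} {p : P}
    {x : M} {v : EP} {w : EM} {C : ℝ} (hC : 0 ≤ C)
    (h : modelForm g p v v ≤ C * modelForm q x w w) :
    metricENorm g p v ≤ ENNReal.ofReal √C * metricENorm q x w := by
  unfold metricENorm
  rw [← ENNReal.ofReal_mul (Real.sqrt_nonneg _), ← Real.sqrt_mul hC]
  exact ENNReal.ofReal_le_ofReal (Real.sqrt_le_sqrt h)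

/-- A Riemannian submersion does not increase distances. -/
lemma metricEDist_le_of_isQuotientForm {g : RiemannianMetric IP P} {q : RiemannianMetric IM M}
    {f : P → M} (hf : ContMDiff IP IM ∞ f)
    (hq : ∀ p, IsQuotientForm (fun v w => modelForm g p v w) (modelDeriv IP IM f p)
      (fun v w => modelForm q (f p) v w)) (p p' : P) :
    metricEDist IM q (f p) (f p') ≤ metricEDist IP g p p' := by
  refine le_of_forall_gt fun r hr => ?_
  obtain ⟨γ, h0, h1, hγ, hl⟩ := exists_metricLength_lt g hr
  refine lt_of_le_of_lt ?_ hl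
  have h := metricEDist_comp_le g q (C := ENNReal.ofReal √1) ENNReal.ofReal_ne_top hγ
    zero_le_one (φ := f) (fun t _ => (hf.of_le (by simp)).contMDiffAt)
    (fun t _ u => metricENorm_le_of_form_le zero_le_one (by
      rw [one_mul]
      exact (hq (γ t)).le (modelForm_symm g _) (modelForm_pos g _) u))
  simpa [h0, h1] using h

/-- A Riemannian submersion has a local section through `p₀`, horizontal at `p₀`, which stretches
tangent vectors around `f p₀` by a factor arbitrarily close to `1`. -/
lemma exists_local_section_form_le [IP.Boundaryless] [IM.Boundaryless]
    [FiniteDimensional ℝ EP] [FiniteDimensional ℝ EM]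
    {g : RiemannianMetric IP P} {q : RiemannianMetric IM M}
    {f : P → M} (hf : ContMDiff IP IM ∞ f) (p₀ : P)
    (hq : IsQuotientForm (fun v w => modelForm g p₀ v w) (modelDeriv IP IM f p₀)
      (fun v w => modelForm q (f p₀) v w)) {C : ℝ} (hC : 1 < C) :
    ∃ s : M → P, ∀ᶠ x in 𝓝 (f p₀), ContMDiffAt IM IP 1 s x ∧ f (s x) = x ∧
      ∀ u, modelForm g (s x) (modelDeriv IM IP s x u) (modelDeriv IM IP s x u)
        ≤ C * modelForm q x u u := by
  obtain ⟨h, h1, h2⟩ := hq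
  obtain ⟨s, hs, hs0, hfs, hds⟩ := exists_local_section hf.contMDiffAt
    (LinearMap.toContinuousLinearMap h) h1
  let x₀ := f p₀
  let D : M → EM →L[ℝ] EP := fun x => modelDeriv IM IP s x ∘L modelFrame IM x₀ x
  let T : M → EM →L[ℝ] EM →L[ℝ] ℝ := fun x => C • coordForm q x₀ x -
    ContinuousLinearMap.precomp ℝ (D x) ∘L modelForm g (s x) ∘L D x
  have hT : ∀ x u v, T x u v = C * coordForm q x₀ x u v - modelForm g (s x) (D x u) (D x v) :=
    fun x u v => rfl
  have hTc : ContMDiffAt IM 𝓘(ℝ, EM →L[ℝ] EM →L[ℝ] ℝ) ∞ T x₀ := by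
    refine contMDiffAt_clm_of_apply fun u => contMDiffAt_clm_of_apply fun v => ?_
    have hF := fun u : EM => contMDiffAt_frame (I := IM) x₀ u (mem_baseSet_self x₀)
    have hD := fun u : EM => contMDiffAt_mfderiv_frame (I' := IP) hs (hF u)
    exact (contMDiffAt_const.mul (contMDiffAt_inner q (hF u) (hF v))).sub
      (contMDiffAt_inner g (hD u) (hD v))
  have hT0 : ∀ v, v ≠ 0 → 0 < T x₀ v v := by
    intro v hv
    have hpos := coordForm_pos q (mem_baseSet_self x₀) v hv
    have h3 : D x₀ v = h (modelFrame IM x₀ x₀ v) := by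
      change modelDeriv IM IP s (f p₀) (modelFrame IM x₀ x₀ v) = _
      rw [hds]
      rfl
    have h4 : modelForm g (s x₀) (D x₀ v) (D x₀ v) = coordForm q x₀ x₀ v v := by
      have h5 : s x₀ = p₀ := hs0
      rw [h3, h5, coordForm_apply]
      refine (h2 _ _).trans ?_
      rw [h1]
    rw [hT, h4]
    nlinarith
  have hs1 : ∀ᶠ x in 𝓝 (f p₀), ContMDiffAt IM IP 1 s x :=
    contMDiffAt_iff_contMDiffAt_nhds (by simp) |>.1 (hs.of_le (by simp))
  refine ⟨s, ?_⟩
  filter_upwards [hs1, hfs, eventually_form_nonneg hTc.continuousAt hT0,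
    eventually_mem_baseSet (I := IM) x₀] with x hx1 hx2 hx3 hx4
  refine ⟨hx1, hx2, fun u => ?_⟩
  obtain ⟨e, he⟩ := exists_equiv_modelFrame hx4
  have h5 := hx3 (e.symm u)
  have h6 : modelFrame IM x₀ x (e.symm u) = u := by
    rw [← he]
    simp
  have h7 : D x (e.symm u) = modelDeriv IM IP s x u := congrArg _ h6
  rw [hT, coordForm_apply, h6, h7] at h5
  linarith

variable {K : Type*} [Group K] [MulAction K P]

lemma modelForm_smul {g : RiemannianMetric IP P} (hg : IsInvariantMetric IP K g) (k : K) (p : P)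
    (v w : EP) :
    modelForm g (k • p) (modelDeriv IP IP (fun p : P => k • p) p v)
      (modelDeriv IP IP (fun p : P => k • p) p w) = modelForm g p v w := hg k p v w

/-- Let `K` act by isometries on `P`, transitively on the fibres of the Riemannian submersion `f`,
by maps over `M`. Up to a factor arbitrarily close to `1`, paths in `M` lift to `P`, from any given
initial point, without gaining length: on short pieces of the path, local sections provide lifts, and
`K` moves them so that they fit together. -/
lemma exists_lift_metricEDist_le [IP.Boundaryless] [IM.Boundaryless]
    [FiniteDimensional ℝ EP] [FiniteDimensional ℝ EM]
    (hk : ∀ k : K, ContMDiff IP IP ∞ fun p : P => k • p)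
    {g : RiemannianMetric IP P} (hg : IsInvariantMetric IP K g) {q : RiemannianMetric IM M}
    {f : P → M} (hf : ContMDiff IP IM ∞ f) (hsurj : Function.Surjective f)
    (hfib : ∀ p p', f p = f p' → ∃ k : K, k • p = p' ∧ ∀ y, f (k • y) = f y)
    (hq : ∀ p, IsQuotientForm (fun v w => modelForm g p v w) (modelDeriv IP IM f p)
      (fun v w => modelForm q (f p) v w)) {C : ℝ} (hC : 1 < C) {γ : ℝ → M}
    (hγ : ContMDiff 𝓘(ℝ) IM 1 γ) (p : P) (hp : f p = γ 0) :
    ∃ p', f p' = γ 1 ∧ metricEDist IP g p p' ≤ ENNReal.ofReal √C * metricLength q γ 0 1 := by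
  have hloc : ∀ x : M, ∃ s : M → P, ∃ U : Set M, IsOpen U ∧ x ∈ U ∧ ∀ y ∈ U,
      ContMDiffAt IM IP 1 s y ∧ f (s y) = y ∧
      ∀ u, modelForm g (s y) (modelDeriv IM IP s y u) (modelDeriv IM IP s y u)
        ≤ C * modelForm q y u u := by
    intro x
    obtain ⟨p₀, rfl⟩ := hsurj x
    obtain ⟨s, hs⟩ := exists_local_section_form_le hf p₀ (hq p₀) hC
    obtain ⟨U, hU, hUo, hxU⟩ := eventually_nhds_iff.1 hs
    exact ⟨s, U, hUo, hxU, hU⟩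
  choose s U hUo hxU hU using hloc
  obtain ⟨t, ht0, htm, ⟨m, hm⟩, htc⟩ := exists_monotone_Icc_subset_open_cover_Icc
    (zero_le_one' ℝ) (c := fun x : M => {t : Icc (0 : ℝ) 1 | γ t ∈ U x})
    (fun x => (hUo x).preimage (hγ.continuous.comp continuous_subtype_val))
    (fun t _ => mem_iUnion.2 ⟨γ t, hxU _⟩)
  have key : ∀ n, ∃ p', f p' = γ (t n) ∧
      metricEDist IP g p p' ≤ ENNReal.ofReal √C * metricLength q γ 0 (t n) := by
    intro n
    induction n with
    | zero => exact ⟨p, by rw [hp, ht0], by rw [metricEDist_self]; exact zero_le⟩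
    | succ n ih =>
      obtain ⟨p', hp', hd⟩ := ih
      obtain ⟨x, hx⟩ := htc n
      have hle : (t n : ℝ) ≤ t (n + 1) := htm n.le_succ
      have hx' : ∀ r ∈ Icc (t n : ℝ) (t (n + 1)), γ r ∈ U x := fun r hr =>
        hx (show (⟨r, (t n).2.1.trans hr.1, hr.2.trans (t (n + 1)).2.2⟩ : Icc (0 : ℝ) 1) ∈
          Icc (t n) (t (n + 1)) from hr)
      have hfs := (hU x (γ (t n)) (hx' _ ⟨le_rfl, hle⟩)).2.1
      obtain ⟨k, hkp, hkf⟩ := hfib (s x (γ (t n))) p' (by rw [hfs, hp'])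
      refine ⟨k • s x (γ (t (n + 1))), ?_, ?_⟩
      · rw [hkf, (hU x _ (hx' _ ⟨hle, le_rfl⟩)).2.1]
      · have hstep := metricEDist_comp_le q g (φ := fun y => k • s x y)
          (C := ENNReal.ofReal √C) ENNReal.ofReal_ne_top hγ hle
          (fun r hr => ((hk k).of_le (by simp)).contMDiffAt.comp _ (hU x _ (hx' r hr)).1)
          (fun r hr u => metricENorm_le_of_form_le (by linarith) (by
            have h1 := modelDeriv_comp (γ r) (g := fun p : P => k • p) (f := s x)
              ((hk k).mdifferentiableAt (by simp))
              ((hU x _ (hx' r hr)).1.mdifferentiableAt (by simp))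
            change modelForm g _ (modelDeriv IM IP ((fun p : P => k • p) ∘ s x) (γ r) u)
              (modelDeriv IM IP ((fun p : P => k • p) ∘ s x) (γ r) u) ≤ _
            rw [h1]
            exact (modelForm_smul hg k _ _ _).trans_le ((hU x _ (hx' r hr)).2.2 u)))
        rw [hkp] at hstep
        calc metricEDist IP g p (k • s x (γ (t (n + 1))))
            ≤ metricEDist IP g p p' + metricEDist IP g p' (k • s x (γ (t (n + 1)))) :=
              metricEDist_triangle g _ _ _
          _ ≤ ENNReal.ofReal √C * metricLength q γ 0 (t n)
              + ENNReal.ofReal √C * metricLength q γ (t n) (t (n + 1)) := add_le_add hd hstep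
          _ = _ := by rw [← mul_add, metricLength_add q γ (t n).2.1 hle]
  obtain ⟨p', h1, h2⟩ := key m
  rw [hm m le_rfl] at h1 h2
  exact ⟨p', h1, h2⟩

/-- The distance of a point `p` to the fibre of the Riemannian submersion `f` over `y` is at most the
distance of `f p` and `y`. -/
theorem iInf_metricEDist_le [IP.Boundaryless] [IM.Boundaryless]
    [FiniteDimensional ℝ EP] [FiniteDimensional ℝ EM]
    (hk : ∀ k : K, ContMDiff IP IP ∞ fun p : P => k • p)
    {g : RiemannianMetric IP P} (hg : IsInvariantMetric IP K g) {q : RiemannianMetric IM M}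
    {f : P → M} (hf : ContMDiff IP IM ∞ f) (hsurj : Function.Surjective f)
    (hfib : ∀ p p', f p = f p' → ∃ k : K, k • p = p' ∧ ∀ y, f (k • y) = f y)
    (hq : ∀ p, IsQuotientForm (fun v w => modelForm g p v w) (modelDeriv IP IM f p)
      (fun v w => modelForm q (f p) v w)) (p : P) (y : M) :
    ⨅ p' ∈ f ⁻¹' {y}, metricEDist IP g p p' ≤ metricEDist IM q (f p) y := by
  refine le_of_forall_gt fun r hr => ?_
  obtain ⟨γ, h0, h1, hγ, hl⟩ := exists_metricLength_lt q hr
  -- the factor `√C` is absorbed by the gap between the length of `γ` and `r`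
  obtain ⟨C, hC, hCr⟩ : ∃ C : ℝ, 1 < C ∧ ENNReal.ofReal √C * metricLength q γ 0 1 < r := by
    have h2 : Filter.Tendsto (fun C : ℝ => ENNReal.ofReal √C * metricLength q γ 0 1) (𝓝[>] 1)
        (𝓝 (ENNReal.ofReal √1 * metricLength q γ 0 1)) := by
      refine ENNReal.Tendsto.mul_const ?_ (Or.inr hl.ne_top)
      exact ((ENNReal.continuous_ofReal.comp Real.continuous_sqrt).tendsto 1).mono_left
        nhdsWithin_le_nhds
    have h3 : ∀ᶠ C : ℝ in 𝓝[>] 1, ENNReal.ofReal √C * metricLength q γ 0 1 < r :=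
      h2.eventually (gt_mem_nhds (by simpa using hl))
    obtain ⟨C, hC, hC'⟩ := (h3.and self_mem_nhdsWithin).exists
    exact ⟨C, hC', hC⟩
  obtain ⟨p', hp', hd⟩ := exists_lift_metricEDist_le hk hg hf hsurj hfib hq hC hγ p h0.symm
  exact (iInf₂_le p' (hp'.trans h1)).trans_lt (hd.trans_lt hCr)

end Submersion

/-! ### Submersions and equivariance -/

section Submersion

variable {EP HP : Type*} [NormedAddCommGroup EP] [NormedSpace ℝ EP] [TopologicalSpace HP]
  {IP : ModelWithCorners ℝ EP HP}
  {P : Type*} [TopologicalSpace P] [ChartedSpace HP P]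
  {EM HM : Type*} [NormedAddCommGroup EM] [NormedSpace ℝ EM] [TopologicalSpace HM]
  {IM : ModelWithCorners ℝ EM HM}
  {M : Type*} [TopologicalSpace M] [ChartedSpace HM M]

/-- A map with a local section through a point is a submersion there. -/
lemma surjective_modelDeriv_of_section {f : P → M} {s : M → P} {x : M}
    (hf : MDifferentiableAt IP IM f (s x)) (hs : MDifferentiableAt IM IP s x)
    (hfs : ∀ᶠ y in 𝓝 x, f (s y) = y) : Function.Surjective (modelDeriv IP IM f (s x)) := by
  have h1 := modelDeriv_comp x hf hs
  have h2 : modelDeriv IM IM (f ∘ s) x = ContinuousLinearMap.id ℝ EM := by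
    rw [← modelDeriv_id (IP := IM) x]
    exact Filter.EventuallyEq.mfderiv_eq hfs
  rw [h2] at h1
  exact fun w => ⟨modelDeriv IM IP s x w, (congrArg (fun A : EM →L[ℝ] EM => A w) h1).symm⟩

lemma surjective_modelDeriv_of_isSubmersion [IP.Boundaryless] [IsManifold IP ∞ P]
    [IsManifold IM ∞ M] {f : P → M} (hf : Manifold.IsSubmersion IP IM ∞ f) (p : P) :
    Function.Surjective (modelDeriv IP IM f p) := by
  obtain ⟨F, _, _, hF⟩ := hf
  have h := hF p
  let φ := h.domChart.extend IP
  let ψ := h.codChart.extend IM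
  -- in charts `f` is a projection `(u, v) ↦ u`, with section `u ↦ (u, v)`
  let c : EM → EP := fun u => h.equiv.symm (u, (h.equiv (φ p)).2)
  let s : M → P := fun y => φ.symm (c (ψ y))
  have hpφ : p ∈ φ.source := by
    rw [OpenPartialHomeomorph.extend_source]
    exact h.mem_domChart_source
  have hfψ : f p ∈ ψ.source := by
    rw [OpenPartialHomeomorph.extend_source]
    exact h.mem_codChart_source
  have hto : IsOpen φ.target := h.domChart.isOpen_extend_target
  have hpt : φ p ∈ φ.target := φ.map_source hpφ
  have hwr : ∀ z ∈ φ.target, ψ (f (φ.symm z)) = (h.equiv z).1 := fun z hz => h.writtenInCharts hz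
  have hc0 : c (ψ (f p)) = φ p := by
    have h1 := hwr _ hpt
    rw [φ.left_inv hpφ] at h1
    simp only [c, h1, Prod.mk.eta, ContinuousLinearEquiv.symm_apply_apply]
  have hs0 : s (f p) = p := by
    simp only [s, hc0]
    exact φ.left_inv hpφ
  have hψ : ContMDiffAt IM 𝓘(ℝ, EM) ∞ ψ (f p) :=
    h.codChart.contMDiffAt_extend h.codChart_mem_maximalAtlas h.mem_codChart_source
  have hc : ContMDiff 𝓘(ℝ, EM) 𝓘(ℝ, EP) ∞ c :=
    (h.equiv.symm.contDiff.comp (contDiff_id.prodMk contDiff_const)).contMDiff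
  have hcψ : ContMDiffAt IM 𝓘(ℝ, EP) ∞ (fun y => c (ψ y)) (f p) :=
    hc.contMDiffAt.comp (f p) hψ
  have hφ : ContMDiffAt 𝓘(ℝ, EP) IP ∞ φ.symm (φ p) := by
    have h1 := contMDiffOn_extend_symm h.domChart_mem_maximalAtlas
    rw [← OpenPartialHomeomorph.extend_target'] at h1
    exact h1.contMDiffAt (hto.mem_nhds hpt)
  have hs : ContMDiffAt IM IP ∞ s (f p) :=
    ContMDiffAt.comp (g := φ.symm) (f p) (by rwa [hc0]) hcψ
  have hfs : ∀ᶠ y in 𝓝 (f p), f (s y) = y := by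
    have h1 : ∀ᶠ y in 𝓝 (f p), c (ψ y) ∈ φ.target :=
      hcψ.continuousAt.eventually (by simp only [hc0]; exact hto.mem_nhds hpt)
    filter_upwards [h1, h.codChart.open_source.mem_nhds h.mem_codChart_source] with y hy1 hy2
    have h2 : φ.symm (c (ψ y)) ∈ h.domChart.source := by
      rw [← OpenPartialHomeomorph.extend_source h.domChart (I := IP)]
      exact φ.map_target hy1
    have h3 := hwr _ hy1
    simp only [c, ContinuousLinearEquiv.apply_symm_apply] at h3
    refine ψ.injOn ?_ ?_ h3
    · rw [OpenPartialHomeomorph.extend_source]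
      exact h.source_subset_preimage_source h2
    · rwa [OpenPartialHomeomorph.extend_source]
  have h4 := surjective_modelDeriv_of_section (f := f) (s := s) (x := f p)
    (by rw [hs0]; exact h.contMDiffAt.mdifferentiableAt (by simp)) (hs.mdifferentiableAt (by simp))
    hfs
  rwa [hs0] at h4

/-- Differentiability descends along submersions. -/
lemma mdifferentiable_of_comp_submersion [FiniteDimensional ℝ EM] [FiniteDimensional ℝ EP]
    [IP.Boundaryless] [IM.Boundaryless] [IsManifold IP ∞ P] [IsManifold IM ∞ M] {f : P → M}
    (hf : ContMDiff IP IM ∞ f) (hsurj : Function.Surjective f)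
    (hd : ∀ p, Function.Surjective (modelDeriv IP IM f p))
    {E' H' N : Type*} [NormedAddCommGroup E'] [NormedSpace ℝ E'] [TopologicalSpace H']
    {I' : ModelWithCorners ℝ E' H'} [TopologicalSpace N] [ChartedSpace H' N] {ψ : M → N}
    (hψ : MDifferentiable IP I' (ψ ∘ f)) : MDifferentiable IM I' ψ := by
  intro x
  obtain ⟨p, rfl⟩ := hsurj x
  obtain ⟨L, hL⟩ := (modelDeriv IP IM f p).toLinearMap.exists_rightInverse_of_surjective
    (LinearMap.range_eq_top.2 (hd p))
  obtain ⟨s, hs, hs0, hfs, -⟩ := exists_local_section hf.contMDiffAt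
    (LinearMap.toContinuousLinearMap L) (fun w => LinearMap.congr_fun hL w)
  have h1 : MDifferentiableAt IM I' ((ψ ∘ f) ∘ s) (f p) :=
    (hψ _).comp (f p) (hs.mdifferentiableAt (by simp))
  refine h1.congr_of_eventuallyEq ?_
  filter_upwards [hfs] with y hy
  simp only [Function.comp_apply, hy]

end Submersion

section Equivariant

variable {EP HP : Type*} [NormedAddCommGroup EP] [NormedSpace ℝ EP] [TopologicalSpace HP]
  {IP : ModelWithCorners ℝ EP HP} [IP.Boundaryless] [FiniteDimensional ℝ EP]
  {P : Type*} [TopologicalSpace P] [ChartedSpace HP P] [IsManifold IP ∞ P]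
  {EM HM : Type*} [NormedAddCommGroup EM] [NormedSpace ℝ EM] [TopologicalSpace HM]
  {IM : ModelWithCorners ℝ EM HM} [IM.Boundaryless] [FiniteDimensional ℝ EM]
  {M : Type*} [TopologicalSpace M] [ChartedSpace HM M] [IsManifold IM ∞ M]
  {K G : Type*} [Group K] [MulAction K P] [Group G] [MulAction G M]

lemma mdifferentiable_smul_of_equivariant (hk : ∀ k : K, ContMDiff IP IP ∞ fun p : P => k • p)
    {f : P → M} (hf : ContMDiff IP IM ∞ f) (hsurj : Function.Surjective f)
    (hd : ∀ p, Function.Surjective (modelDeriv IP IM f p)) {k : K} {a : G}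
    (ha : ∀ p, f (k • p) = a • f p) : MDifferentiable IM IM (fun x : M => a • x) := by
  refine mdifferentiable_of_comp_submersion hf hsurj hd ?_
  have h1 : (fun x : M => a • x) ∘ f = f ∘ fun p : P => k • p := funext fun p => (ha p).symm
  rw [h1]
  exact (hf.comp (hk k)).mdifferentiable (by simp)

/-- The quotient of an invariant metric along an equivariant map is invariant. -/
lemma isInvariantMetric_of_isQuotientForm (hk : ∀ k : K, ContMDiff IP IP ∞ fun p : P => k • p)
    {g : RiemannianMetric IP P} (hg : IsInvariantMetric IP K g)
    {f : P → M} (hf : ContMDiff IP IM ∞ f) (hsurj : Function.Surjective f)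
    (hd : ∀ p, Function.Surjective (modelDeriv IP IM f p))
    (hfG : ∀ a : G, ∃ k : K, ∀ p, f (k • p) = a • f p) {q : RiemannianMetric IM M}
    (hq : ∀ p, IsQuotientForm (fun v w => modelForm g p v w) (modelDeriv IP IM f p)
      (fun v w => modelForm q (f p) v w)) : IsInvariantMetric IM G q := by
  have hm : ∀ a : G, MDifferentiable IM IM (fun x : M => a • x) := by
    intro a
    obtain ⟨k, hka⟩ := hfG a
    exact mdifferentiable_smul_of_equivariant hk hf hsurj hd hka
  intro a x v w
  obtain ⟨p, rfl⟩ := hsurj x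
  obtain ⟨k, hka⟩ := hfG a
  have hinj : Function.Injective (modelDeriv IM IM (fun x : M => a • x) (f p)) := by
    have h1 := modelDeriv_comp (f p) (g := fun x : M => a⁻¹ • x) (f := fun x : M => a • x)
      (hm a⁻¹ _) (hm a _)
    have h2 : (fun x : M => a⁻¹ • x) ∘ (fun x : M => a • x) = id := by ext; simp
    rw [h2, modelDeriv_id] at h1
    exact Function.LeftInverse.injective fun v =>
      (congrArg (fun A : EM →L[ℝ] EM => A v) h1).symm
  have h3 := quotientForm_smul_eq hg hf hk (hm a) hka (p := p) hinj (hq p) (hq (k • p)) v w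
  rw [hka] at h3
  exact h3

/-- Adding to an invariant metric the pullback, along an equivariant map, of the difference of two
invariant metrics preserves invariance. -/
lemma isInvariantMetric_of_eq_add_sub (hk : ∀ k : K, ContMDiff IP IP ∞ fun p : P => k • p)
    {g g' : RiemannianMetric IP P} (hg : IsInvariantMetric IP K g)
    {f : P → M} (hf : ContMDiff IP IM ∞ f) (hsurj : Function.Surjective f)
    (hd : ∀ p, Function.Surjective (modelDeriv IP IM f p))
    (hfK : ∀ k : K, ∃ a : G, ∀ p, f (k • p) = a • f p) {q₁ q₂ : RiemannianMetric IM M}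
    (hq₁ : IsInvariantMetric IM G q₁) (hq₂ : IsInvariantMetric IM G q₂)
    (hg' : ∀ p v w, modelForm g' p v w = modelForm g p v w
        + modelForm q₁ (f p) (modelDeriv IP IM f p v) (modelDeriv IP IM f p w)
        - modelForm q₂ (f p) (modelDeriv IP IM f p v) (modelDeriv IP IM f p w)) :
    IsInvariantMetric IP K g' := by
  suffices h : ∀ (k : K) (p : P) (v w : EP),
      modelForm g' (k • p) (modelDeriv IP IP (fun p : P => k • p) p v)
        (modelDeriv IP IP (fun p : P => k • p) p w) = modelForm g' p v w from h
  intro k p v w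
  obtain ⟨a, ha⟩ := hfK k
  have h1 := fun v : EP => congrArg (fun A : EP →L[ℝ] EM => A v) (modelDeriv_smul hf (hk k)
    (mdifferentiable_smul_of_equivariant hk hf hsurj hd ha) ha p)
  simp only [ContinuousLinearMap.comp_apply] at h1
  have h2 := modelForm_smul hq₁ a (f p) (modelDeriv IP IM f p v) (modelDeriv IP IM f p w)
  have h3 := modelForm_smul hq₂ a (f p) (modelDeriv IP IM f p v) (modelDeriv IP IM f p w)
  rw [hg', hg', modelForm_smul hg, h1, h1, ha, h2, h3]

/-- The orbit distance of the base of a Riemannian submersion is a distance of subsets of the total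
space. -/
lemma orbitEDist_eq_iInf (hk : ∀ k : K, ContMDiff IP IP ∞ fun p : P => k • p)
    {g : RiemannianMetric IP P} (hg : IsInvariantMetric IP K g) {q : RiemannianMetric IM M}
    {f : P → M} (hf : ContMDiff IP IM ∞ f) (hsurj : Function.Surjective f)
    (hfib : ∀ p p', f p = f p' → ∃ k : K, k • p = p' ∧ ∀ y, f (k • y) = f y)
    (hq : ∀ p, IsQuotientForm (fun v w => modelForm g p v w) (modelDeriv IP IM f p)
      (fun v w => modelForm q (f p) v w)) (a b : MulAction.orbitRel.Quotient G M) :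
    orbitEDist IM G q a b =
      ⨅ p ∈ f ⁻¹' a.orbit, ⨅ p' ∈ f ⁻¹' b.orbit, metricEDist IP g p p' := by
  unfold orbitEDist
  apply le_antisymm
  · refine le_iInf₂ fun p hp => le_iInf₂ fun p' hp' => ?_
    exact (iInf₂_le (f p) hp).trans ((iInf₂_le (f p') hp').trans
      (metricEDist_le_of_isQuotientForm hf hq p p'))
  · refine le_iInf₂ fun x hx => le_iInf₂ fun y hy => ?_
    obtain ⟨p, rfl⟩ := hsurj x
    refine (iInf₂_le p hx).trans (le_trans ?_ (iInf_metricEDist_le hk hg hf hsurj hfib hq p y))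
    refine le_iInf₂ fun p' hp' => iInf₂_le p' ?_
    rw [Set.mem_preimage, Set.mem_singleton_iff] at hp'
    rwa [Set.mem_preimage, hp']

end Equivariant

/-! ### Orbit spaces -/

section Orbits

/-- Two surjections of a set `P` onto `G`-sets that induce the same relation on `P` identify the orbit
spaces. -/
lemma exists_orbitQuotient_equiv {G P M M' : Type*} [Group G] [MulAction G M] [MulAction G M']
    {π : P → M} {π' : P → M'} (hπ : Function.Surjective π) (hπ' : Function.Surjective π')
    (h : ∀ p q, π p ∈ MulAction.orbit G (π q) ↔ π' p ∈ MulAction.orbit G (π' q)) :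
    ∃ e : MulAction.orbitRel.Quotient G M ≃ MulAction.orbitRel.Quotient G M',
      ∀ a, π' ⁻¹' (e a).orbit = π ⁻¹' a.orbit := by
  let j : P → MulAction.orbitRel.Quotient G M := fun p => Quotient.mk _ (π p)
  let j' : P → MulAction.orbitRel.Quotient G M' := fun p => Quotient.mk _ (π' p)
  have hj : Function.Surjective j := Quotient.mk_surjective.comp hπ
  have hj' : Function.Surjective j' := Quotient.mk_surjective.comp hπ'
  have hjj' : ∀ p q, j p = j q ↔ j' p = j' q := fun p q =>
    (Quotient.eq (r := MulAction.orbitRel G M)).trans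
      ((h p q).trans (Quotient.eq (r := MulAction.orbitRel G M')).symm)
  -- `e` sends the class of `π p` to the class of `π' p`
  let u := Function.surjInv hj
  have hu : ∀ a, j (u a) = a := Function.surjInv_eq hj
  have he : ∀ p, j' (u (j p)) = j' p := fun p => (hjj' _ _).1 (hu _)
  refine ⟨Equiv.ofBijective (fun a => j' (u a)) ⟨fun a b hab => ?_, fun b => ?_⟩, fun a => ?_⟩
  · rw [← hu a, ← hu b]
    exact (hjj' _ _).2 hab
  · obtain ⟨p, rfl⟩ := hj' b
    exact ⟨j p, he p⟩
  · ext p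
    simp only [Set.mem_preimage, MulAction.orbitRel.Quotient.mem_orbit]
    change j' p = j' (u a) ↔ j p = a
    rw [← hjj', hu]

end Orbits

/-! ### The two projections of a bundle -/

namespace IsGGBundle

variable {EG HG EP HP EM HM EM' HM' : Type*}
  [NormedAddCommGroup EG] [NormedSpace ℝ EG] [TopologicalSpace HG]
  [NormedAddCommGroup EP] [NormedSpace ℝ EP] [TopologicalSpace HP]
  [NormedAddCommGroup EM] [NormedSpace ℝ EM] [TopologicalSpace HM]
  [NormedAddCommGroup EM'] [NormedSpace ℝ EM'] [TopologicalSpace HM']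
  {IG : ModelWithCorners ℝ EG HG} {IP : ModelWithCorners ℝ EP HP}
  {IM : ModelWithCorners ℝ EM HM} {IM' : ModelWithCorners ℝ EM' HM'}
  {G P M M' : Type*}
  [Group G] [TopologicalSpace G] [ChartedSpace HG G]
  [TopologicalSpace P] [ChartedSpace HP P]
  [TopologicalSpace M] [ChartedSpace HM M]
  [TopologicalSpace M'] [ChartedSpace HM' M']
  [MulAction (G × G) P] [MulAction G M] [MulAction G M'] {π : P → M} {π' : P → M'}

lemma proj_smul (h : IsGGBundle (G := G) IG IP IM IM' π π') (k : G × G) (p : P) :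
    π (k • p) = k.1 • π p := by
  have h1 : k • p = starAct k.1 (principalAct p k.2⁻¹) := by
    simp only [starAct, principalAct, ← mul_smul]
    simp
  rw [h1, h.smul_proj, h.isPrincipalBundle.proj_act]

lemma proj_smul' (h : IsGGBundle (G := G) IG IP IM IM' π π') (k : G × G) (p : P) :
    π' (k • p) = k.2 • π' p := by
  have h1 : k • p = starAct k.1 (principalAct p k.2⁻¹) := by
    simp only [starAct, principalAct, ← mul_smul]
    simp
  rw [h1, ← h.smul_proj']
  exact ((h.fibre' _ _).2 ⟨k.1, rfl⟩).symm

lemma surjective (h : IsGGBundle (G := G) IG IP IM IM' π π') : Function.Surjective π := by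
  intro x
  obtain ⟨e, hx, -⟩ := h.isPrincipalBundle.locally_trivial x
  exact ⟨e.toOpenPartialHomeomorph.symm (x, 1), e.proj_symm_apply' hx⟩

lemma exists_principalAct_eq (h : IsGGBundle (G := G) IG IP IM IM' π π') {p q : P}
    (hpq : π p = π q) : ∃ s : G, principalAct p s = q := by
  obtain ⟨e, hx, -, -, he⟩ := h.isPrincipalBundle.locally_trivial (π p)
  have hp : p ∈ e.source := e.mem_source.2 hx
  have hq : q ∈ e.source := e.mem_source.2 (hpq ▸ hx)
  refine ⟨(e p).2⁻¹ * (e q).2, e.injOn (e.mem_source.2 ?_) hq ?_⟩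
  · rwa [h.isPrincipalBundle.proj_act]
  · change e (principalAct p _) = e q
    rw [he p hp]
    ext
    · rw [e.coe_fst hp, e.coe_fst hq, hpq]
    · simp

lemma exists_smul_eq (h : IsGGBundle (G := G) IG IP IM IM' π π') {p q : P}
    (hpq : π p = π q) : ∃ k : G × G, k • p = q ∧ ∀ y, π (k • y) = π y := by
  obtain ⟨s, hs⟩ := h.exists_principalAct_eq hpq
  exact ⟨(1, s⁻¹), hs, fun y => h.isPrincipalBundle.proj_act y s⟩

lemma exists_smul_eq' (h : IsGGBundle (G := G) IG IP IM IM' π π') {p q : P}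
    (hpq : π' p = π' q) : ∃ k : G × G, k • p = q ∧ ∀ y, π' (k • y) = π' y := by
  obtain ⟨r, hr⟩ := (h.fibre' p q).1 hpq
  exact ⟨(r, 1), hr, fun y => ((h.fibre' _ _).2 ⟨r, rfl⟩).symm⟩

/-- The orbits of `G` on `M` and on `M'` both correspond to the orbits of `G × G` on `P`. -/
lemma mem_orbit_iff (h : IsGGBundle (G := G) IG IP IM IM' π π') (p q : P) :
    π p ∈ MulAction.orbit G (π q) ↔ π' p ∈ MulAction.orbit G (π' q) := by
  constructor
  · rintro ⟨r, hr⟩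
    obtain ⟨k, hk, -⟩ := h.exists_smul_eq (p := (r, (1 : G)) • q) (q := p)
      (by rw [h.proj_smul]; exact hr)
    refine ⟨(k * (r, 1)).2, ?_⟩
    rw [← hk, ← mul_smul, h.proj_smul']
  · rintro ⟨s, hs⟩
    obtain ⟨k, hk, -⟩ := h.exists_smul_eq' (p := ((1 : G), s) • q) (q := p)
      (by rw [h.proj_smul']; exact hs)
    refine ⟨(k * (1, s)).1, ?_⟩
    rw [← hk, ← mul_smul, h.proj_smul]

lemma surjective_modelDeriv (h : IsGGBundle (G := G) IG IP IM IM' π π') (p : P) :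
    Function.Surjective (modelDeriv IP IM π p) := by
  obtain ⟨e, hx, -, he, -⟩ := h.isPrincipalBundle.locally_trivial (π p)
  let s : M → P := fun x => e.toOpenPartialHomeomorph.symm (x, (e p).2)
  have hp : p ∈ e.source := e.mem_source.2 hx
  have hs0 : s (π p) = p := by
    have h1 : (π p, (e p).2) = e p := by rw [← e.coe_fst hp]
    simp only [s, h1]
    exact e.left_inv hp
  have hs : ContMDiffAt IM IP ∞ s (π p) :=
    ContMDiffAt.comp (g := e.toOpenPartialHomeomorph.symm) (π p)
      (he.contMDiffAt (e.open_target.mem_nhds (e.mem_target.2 hx)))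
      (contMDiffAt_id.prodMk contMDiffAt_const)
  have h1 := surjective_modelDeriv_of_section (f := π) (s := s) (x := π p)
    (h.isPrincipalBundle.smooth_proj.mdifferentiableAt (by simp))
    (hs.mdifferentiableAt (by simp)) (by
      filter_upwards [e.open_baseSet.mem_nhds hx] with y hy
      exact e.proj_symm_apply' hy)
  rwa [hs0] at h1

end IsGGBundle

end GGBundle

end

theorem mainTheorem8
    {EG HG EP HP EM HM EM' HM' : Type*}
    [NormedAddCommGroup EG] [NormedSpace ℝ EG] [FiniteDimensional ℝ EG] [TopologicalSpace HG]
    [NormedAddCommGroup EP] [NormedSpace ℝ EP] [FiniteDimensional ℝ EP] [TopologicalSpace HP]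
    [NormedAddCommGroup EM] [NormedSpace ℝ EM] [FiniteDimensional ℝ EM] [TopologicalSpace HM]
    [NormedAddCommGroup EM'] [NormedSpace ℝ EM'] [FiniteDimensional ℝ EM'] [TopologicalSpace HM']
    (IG : ModelWithCorners ℝ EG HG) [IG.Boundaryless]
    (IP : ModelWithCorners ℝ EP HP) [IP.Boundaryless]
    (IM : ModelWithCorners ℝ EM HM) [IM.Boundaryless]
    (IM' : ModelWithCorners ℝ EM' HM') [IM'.Boundaryless]
    {G P M M' : Type*}
    [Group G] [TopologicalSpace G] [ChartedSpace HG G] [LieGroup IG ∞ G]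
    [CompactSpace G] [T2Space G]
    [TopologicalSpace P] [ChartedSpace HP P] [IsManifold IP ∞ P]
    [T2Space P] [SecondCountableTopology P]
    [TopologicalSpace M] [ChartedSpace HM M] [IsManifold IM ∞ M]
    [T2Space M] [SecondCountableTopology M]
    [TopologicalSpace M'] [ChartedSpace HM' M'] [IsManifold IM' ∞ M']
    [T2Space M'] [SecondCountableTopology M']
    [MulAction (G × G) P] [MulAction G M] [MulAction G M']
    (π : P → M) (π' : P → M')
    (hP : GGBundle.IsGGBundle (G := G) IG IP IM IM' π π')
    (gM : GGBundle.RiemannianMetric IM M) (hgM : GGBundle.IsInvariantMetric IM G gM) :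
    ∃ gM' : GGBundle.RiemannianMetric IM' M',
      GGBundle.IsInvariantMetric IM' G gM' ∧
      ∃ e : MulAction.orbitRel.Quotient G M ≃ MulAction.orbitRel.Quotient G M',
        ∀ a b : MulAction.orbitRel.Quotient G M,
          GGBundle.orbitEDist IM' G gM' (e a) (e b) = GGBundle.orbitEDist IM G gM a b := by
  have : IsTopologicalGroup G := topologicalGroup_of_lieGroup IG ∞
  have : LocallyCompactSpace HP := IP.locallyCompactSpace
  have : LocallyCompactSpace P := ChartedSpace.locallyCompactSpace HP P
  have : IsManifold (IG.prod IG) ∞ (G × G) := inferInstance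
  let _ : MeasurableSpace (G × G) := borel (G × G)
  have : BorelSpace (G × G) := ⟨rfl⟩
  have hsmul : ContMDiff ((IG.prod IG).prod IP) IP ∞ (fun p : (G × G) × P => p.1 • p.2) :=
    hP.smooth_smul.contMDiff_smul
  have hk : ∀ k : G × G, ContMDiff IP IP ∞ (fun p : P => k • p) := fun k =>
    hsmul.comp (f := fun p : P => (k, p)) (contMDiff_const.prodMk contMDiff_id)
  have hπ : ContMDiff IP IM ∞ π := hP.isPrincipalBundle.smooth_proj
  have hπ' : ContMDiff IP IM' ∞ π' := hP.submersion'.contMDiff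
  have hd' := GGBundle.surjective_modelDeriv_of_isSubmersion hP.submersion'
  have hfG : ∀ a : G, ∃ k : G × G, ∀ p, π (k • p) = a • π p := fun a =>
    ⟨(a, 1), fun p => hP.proj_smul _ p⟩
  have hfG' : ∀ a : G, ∃ k : G × G, ∀ p, π' (k • p) = a • π' p := fun a =>
    ⟨(1, a), fun p => hP.proj_smul' _ p⟩
  have hfib := fun p q => hP.exists_smul_eq (p := p) (q := q)
  have hfib' := fun p q => hP.exists_smul_eq' (p := p) (q := q)
  -- a `G × G`-invariant metric on `P` with quotient `gM`
  obtain ⟨g₀, hg₀⟩ := GGBundle.exists_invariantMetric (K := G × G) hsmul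
  obtain ⟨q₀, hq₀⟩ := GGBundle.exists_quotientMetric hk hg₀ hπ hP.surjective
    hP.surjective_modelDeriv hfib
  obtain ⟨g, hg, hgM'⟩ := GGBundle.exists_metric_with_quotient g₀ hπ q₀ gM hq₀
  have hginv : GGBundle.IsInvariantMetric IP (G × G) g :=
    GGBundle.isInvariantMetric_of_eq_add_sub hk hg₀ hπ hP.surjective hP.surjective_modelDeriv
      (fun k => ⟨k.1, hP.proj_smul k⟩) hgM
      (GGBundle.isInvariantMetric_of_isQuotientForm hk hg₀ hπ hP.surjective
        hP.surjective_modelDeriv hfG hq₀) hg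
  -- its quotient on `M'`
  obtain ⟨gM', hq'⟩ := GGBundle.exists_quotientMetric hk hginv hπ' hP.surjective' hd' hfib'
  obtain ⟨e, he⟩ := GGBundle.exists_orbitQuotient_equiv hP.surjective hP.surjective'
    hP.mem_orbit_iff
  refine ⟨gM', GGBundle.isInvariantMetric_of_isQuotientForm hk hginv hπ' hP.surjective' hd' hfG'
    hq', e, fun a b => ?_⟩
  rw [GGBundle.orbitEDist_eq_iInf hk hginv hπ' hP.surjective' hfib' hq',
    GGBundle.orbitEDist_eq_iInf hk hginv hπ hP.surjective hfib hgM', he, he]
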